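/- Let $s\ge 2$, let $c_1<\dots<c_s$ and $b_1,\dots,b_s$ be the abscissae and weights of the $s$-point Gauss--Legendre quadrature formula on $[0,1]$, and let $P_j$ ($j=1,\dots,s$) be the Legendre polynomial of degree $j-1$ shifted to $[0,1]$, with positive leading coefficient and normalized so that $\int_0^1 P_iP_j\,d\tau=\delta_{ij}$. Put $\mathcal P=(P_j(c_i))_{i,j=1}^s$, and let $X_s$ be the $s\times s$ tridiagonal matrix with diagonal $(\tfrac12,0,\dots,0)$, subdiagonal $(\xi_1,\dots,\xi_{s-1})$ and superdiagonal $(-\xi_1,\dots,-\xi_{s-1})$, where $\xi_j=\frac{1}{2\sqrt{(2j+1)(2j-1)}}$. Let $r\ge 0$ with $r+1<s$, let $V_r$ be any real skew-symmetric $(r+1)\times(r+1)$ matrix, and let $$\widetilde W_s=\begin{pmatrix}0&0\\0&V_r\end{pmatrix}\in\mathbb R^{s\times s}.$$ Then the $s$-stage Runge--Kutta method with matrix $\mathcal P(X_s+\widetilde W_s)\mathcal P^{-1}$, weights $b_i$ and abscissae $c_i$ has the following properties. 1. It is symplectic: for every Hamiltonian system $\dot y=J\nabla H(y)$, $J=\begin{pmatrix}0&I\\-I&0\end{pmatrix}$,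 with $H$ twice continuously differentiable on an open subset of $\mathbb R^{2m}$, the one-step map $y_0\mapsto y_1=\Phi_h(y_0)$ (which near any point is defined and differentiable for all small $|h|$, through a solution of the implicit stage equations close to that point) satisfies $\Phi_h'(y)^TJ\,\Phi_h'(y)=J$; the same holds, for any $h$, for the one-step map given by any solution of the stage equations that depends differentiably on $y_0$ in an open set. 2. It has order $p=2(s-r)$: for every sufficiently differentiable initial value problem $y'=f(t,y)$, $y(t_0)=y_0$, the stage equations have, for small $|h|$, exactly one solution near $y_0$, and the resulting $y_1$ satisfies $y_1-y(t_0+h)=O(h^{p+1})$ as $h\to0$. If $r=0$, or if the first column of $V_r$ is not zero (so that the perturbation is not already supported in a smaller bottom-right corner), then the order is exactly $2(s-r)$, i.e. the method does not have order $2(s-r)+1$. -/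

import Mathlib

open scoped Topology

noncomputable section

/-- The coefficients `(A, b, c)` of an `s`-stage Runge–Kutta method. -/
structure ButcherTableau (s : ℕ) where
  A : Matrix (Fin s) (Fin s) ℝ
  b : Fin s → ℝ
  c : Fin s → ℝ

namespace ButcherTableau

section Step

variable {s : ℕ} {E : Type*} [AddCommGroup E] [Module ℝ E]

/-- `Y` is a tuple of internal stages of the method for `y' = f t y`, started at `(t₀, y₀)` with
stepsize `h`: `Yᵢ = y₀ + h ∑ⱼ aᵢⱼ f (t₀ + cⱼ h, Yⱼ)`. -/
def IsStages (M : ButcherTableau s) (f : ℝ → E → E) (t₀ h : ℝ) (y₀ : E) (Y : Fin s → E) : Prop :=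
  ∀ i, Y i = y₀ + h • ∑ j, M.A i j • f (t₀ + M.c j * h) (Y j)

/-- The result `y₁ = y₀ + h ∑ⱼ bⱼ f (t₀ + cⱼ h, Yⱼ)` of one step with internal stages `Y`. -/
def step (M : ButcherTableau s) (f : ℝ → E → E) (t₀ h : ℝ) (y₀ : E) (Y : Fin s → E) : E :=
  y₀ + h • ∑ j, M.b j • f (t₀ + M.c j * h) (Y j)

end Step

/-- The method has order (at least) `p`: for every sufficiently differentiable initial value problem
`y' = f t y`, `y t₀ = y₀` on an open domain `U`, and for all small stepsizes `h`, the implicit stage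
equations have exactly one solution near `y₀`, and the local error of the resulting step is
`O(h ^ (p + 1))`. -/
def HasOrder {s : ℕ} (M : ButcherTableau s) (p : ℕ) : Prop :=
  ∃ k : ℕ, ∀ (E : Type) [NormedAddCommGroup E] [NormedSpace ℝ E] [FiniteDimensional ℝ E]
    (U : Set (ℝ × E)) (f : ℝ → E → E) (t₀ : ℝ) (y : ℝ → E),
    IsOpen U → ContDiffOn ℝ k (Function.uncurry f) U → (t₀, y t₀) ∈ U →
    (∀ᶠ t in 𝓝 t₀, HasDerivAt y (f t (y t)) t) →
    ∃ δ > 0, ∃ h₀ > 0, ∃ C : ℝ, ∀ h : ℝ, |h| ≤ h₀ →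
      ∃ Y : Fin s → E,
        ((∀ i, Y i ∈ Metric.ball (y t₀) δ) ∧ M.IsStages f t₀ h (y t₀) Y) ∧
        (∀ Z : Fin s → E, (∀ i, Z i ∈ Metric.ball (y t₀) δ) → M.IsStages f t₀ h (y t₀) Z →
          Z = Y) ∧
        ‖M.step f t₀ h (y t₀) Y - y (t₀ + h)‖ ≤ C * |h| ^ (p + 1)

end ButcherTableau

/-! ### Symplecticity -/

/-- The phase space `ℝ²ᵐ`, with coordinates `(q, p)`. -/
abbrev PhaseSpace (m : ℕ) : Type := Fin m ⊕ Fin m → ℝ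

/-- The structure matrix `J = [0, I; -I, 0]`. -/
def structureMatrix (m : ℕ) : Matrix (Fin m ⊕ Fin m) (Fin m ⊕ Fin m) ℝ :=
  Matrix.fromBlocks 0 1 (-1) 0

/-- The Hamiltonian vector field `J ∇H`. -/
def hamiltonianField {m : ℕ} (H : PhaseSpace m → ℝ) (y : PhaseSpace m) : PhaseSpace m :=
  (structureMatrix m).mulVec fun i => fderiv ℝ H y (Pi.single i 1)

/-- The Jacobian matrix of `Φ` at `y`. -/
def jacobianMatrix {m : ℕ} (Φ : PhaseSpace m → PhaseSpace m) (y : PhaseSpace m) :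
    Matrix (Fin m ⊕ Fin m) (Fin m ⊕ Fin m) ℝ :=
  Matrix.of fun i j => fderiv ℝ Φ y (Pi.single j 1) i

/-- The differentiable map `Φ` is symplectic on `D`: `Φ'(y)ᵀ J Φ'(y) = J` for all `y ∈ D`. -/
def IsSymplecticMapOn {m : ℕ} (Φ : PhaseSpace m → PhaseSpace m) (D : Set (PhaseSpace m)) : Prop :=
  DifferentiableOn ℝ Φ D ∧ ∀ y ∈ D,
    (jacobianMatrix Φ y).transpose * structureMatrix m * jacobianMatrix Φ y = structureMatrix m

namespace ButcherTableau

/-- On the open set `D` of starting points, `Y` is a differentiable family of internal stages, lying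
in `U`, of the method applied with stepsize `h` to `y' = J ∇H(y)`. The stage equations are implicit
and may have several solutions; such a `Y` singles out one solution for each starting point. -/
def IsStageBranch {s m : ℕ} (M : ButcherTableau s) (H : PhaseSpace m → ℝ) (U : Set (PhaseSpace m))
    (h : ℝ) (D : Set (PhaseSpace m)) (Y : PhaseSpace m → Fin s → PhaseSpace m) : Prop :=
  IsOpen D ∧ DifferentiableOn ℝ Y D ∧
    ∀ y ∈ D, (∀ i, Y y i ∈ U) ∧ M.IsStages (fun _ => hamiltonianField H) 0 h y (Y y)

/-- The method is symplectic: whenever it is applied to a Hamiltonian system whose Hamiltonian is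
twice continuously differentiable on an open set `U`, its one-step map is symplectic. The first
clause says that, near each point of `U`, the one-step map is defined for all small stepsizes by a
differentiable branch of internal stages close to that point; the second says that, for every
stepsize, the one-step map given by any differentiable branch of internal stages is symplectic. -/
def IsSymplectic {s : ℕ} (M : ButcherTableau s) : Prop :=
  ∀ (m : ℕ) (U : Set (PhaseSpace m)) (H : PhaseSpace m → ℝ), IsOpen U → ContDiffOn ℝ 2 H U →
    (∀ y₀ ∈ U, ∀ δ > 0, ∃ h₀ > 0, ∃ D : Set (PhaseSpace m), y₀ ∈ D ∧ ∀ h : ℝ, |h| ≤ h₀ →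
      ∃ Y : PhaseSpace m → Fin s → PhaseSpace m, M.IsStageBranch H U h D Y ∧
        ∀ y ∈ D, ∀ i, Y y i ∈ Metric.ball y₀ δ) ∧
    ∀ (h : ℝ) (D : Set (PhaseSpace m)) (Y : PhaseSpace m → Fin s → PhaseSpace m),
      M.IsStageBranch H U h D Y →
      IsSymplecticMapOn (fun y => M.step (fun _ => hamiltonianField H) 0 h y (Y y)) D

end ButcherTableau

/-! ### Gauss quadrature and the perturbed Gauss methods -/

/-- The Legendre polynomial of degree `n`, shifted to `[0, 1]`, with unit norm in `L²(0, 1)` and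
positive leading coefficient. The factor `(-1) ^ n` is there because the leading coefficient of
`Polynomial.shiftedLegendre n` has sign `(-1) ^ n`. -/
def legendrePoly (n : ℕ) : Polynomial ℝ :=
  Polynomial.C (Real.sqrt (2 * n + 1) * (-1) ^ n) *
    (Polynomial.shiftedLegendre n).map (Int.castRingHom ℝ)

/-- The `s` Gauss–Legendre abscissae on `[0, 1]`: the zeros of the Legendre polynomial of degree
`s`, in increasing order (the default value `0` is never used, as there are `s` real zeros). -/
def gaussNode (s : ℕ) (i : Fin s) : ℝ :=
  ((legendrePoly s).roots.sort (· ≤ ·)).getD i 0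

/-- The Gauss–Legendre weights on `[0, 1]`: the integrals of the Lagrange basis polynomials. -/
def gaussWeight (s : ℕ) (i : Fin s) : ℝ :=
  ∫ x in (0 : ℝ)..1, (Lagrange.basis Finset.univ (gaussNode s) i).eval x

/-- The matrix whose `j`-th column holds the values of the Legendre polynomial of degree `j`
(`j = 0, …, s - 1`) at the Gauss–Legendre abscissae. -/
def legendreMatrix (s : ℕ) : Matrix (Fin s) (Fin s) ℝ :=
  Matrix.of fun i j => (legendrePoly j).eval (gaussNode s i)

/-- `ξⱼ = 1 / (2 √((2j+1)(2j-1)))`, used for `j ≥ 1`. -/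
def xi (j : ℕ) : ℝ := 1 / (2 * Real.sqrt ((2 * (j : ℝ) + 1) * (2 * (j : ℝ) - 1)))

/-- The tridiagonal matrix `X_s`: `1/2` in the top-left corner and zeros on the rest of the
diagonal, `ξ₁, …, ξ_{s-1}` below the diagonal and `-ξ₁, …, -ξ_{s-1}` above it (the indices `i`, `j`
start at `0`). -/
def gaussX (s : ℕ) : Matrix (Fin s) (Fin s) ℝ :=
  Matrix.of fun i j =>
    if (i : ℕ) = 0 ∧ (j : ℕ) = 0 then 1 / 2
    else if (i : ℕ) = j + 1 then xi i
    else if (j : ℕ) = i + 1 then -xi j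
    else 0

/-- The `s × s` matrix with `V` in its bottom-right corner and zeros elsewhere. -/
def cornerMatrix (s r : ℕ) (V : Matrix (Fin (r + 1)) (Fin (r + 1)) ℝ) :
    Matrix (Fin s) (Fin s) ℝ :=
  Matrix.of fun i j =>
    if s - (r + 1) ≤ (i : ℕ) ∧ s - (r + 1) ≤ (j : ℕ) then
      V ⟨(i : ℕ) - (s - (r + 1)), by omega⟩ ⟨(j : ℕ) - (s - (r + 1)), by omega⟩
    else 0

/-- The method with matrix `P (X_s + W) P⁻¹`, where `W` has `V` in its bottom-right corner, and with
the Gauss–Legendre abscissae and weights. -/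
def perturbedGauss (s r : ℕ) (V : Matrix (Fin (r + 1)) (Fin (r + 1)) ℝ) : ButcherTableau s where
  A := legendreMatrix s * (gaussX s + cornerMatrix s r V) * (legendreMatrix s)⁻¹
  b := gaussWeight s
  c := gaussNode s

end

/-! ### Shifted Legendre polynomials on `[0, 1]` -/

/-! Let η = s-(r+1). In the orthonormal Legendre basis, X_s is the matrix of the map q' ↦ q (where
q(0) = 0), cut off after degree s-1. The cut is harmless because the Legendre polynomial of degree s
vanishes at the nodes. Quadrature exactness gives P⁻¹ = Pᵀ diag(b), so P X_s P⁻¹ is the Gauss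
matrix, and the perturbation acts only on Legendre coefficients of degree at least η.

This gives three algebraic facts. As V is skew, the symmetric part of X_s + W is half the unit at
the top-left corner, and the first column of P is constant 1. Hence bᵢaᵢⱼ + bⱼaⱼᵢ = bᵢbⱼ. The
quadrature condition B(2s) holds, and the stage condition C(η) holds because W kills polynomials of
degree below η.

The first fact makes the linearized step preserve the symplectic form (`bilin_step_eq`).

The order 2η+2 = 2(s-r) is proved without rooted trees. Stage errors are O(h^(η+1)), so their
quadratic effects are O(h^(2η+2)). What remains is linear and is followed through the moments ∑
bᵢcᵢᵐeᵢ of the stage errors (`vanishesToOrder_slope_moment`). The condition D(η), which follows from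
C(η) and symplecticity, makes the stage equations a recursion between moments that gains one power
of h per pass. The symplectic identity also supplies one condition beyond C(η) and D(η), namely the
value of ∑ bᵢcᵢ^η aᵢⱼ cⱼ^η (`sum_sum_mul_A_mul`), and this gives the last power of h.

For sharpness, if r = 0 the quadrature formula fails in degree 2s. Otherwise two further order
conditions make a positively weighted sum of squares of stage defects vanish, so that C(η+1) holds
and the first column of V is zero. -/

open Polynomial in
/-- The integral over `[0, 1]`, as a linear functional on polynomials. -/
noncomputable def polyIntegral : Polynomial ℝ →ₗ[ℝ] ℝ where
  toFun p := ∫ x in (0 : ℝ)..1, p.eval x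
  map_add' p q := by
    simp only [eval_add]
    exact intervalIntegral.integral_add (p.continuous.intervalIntegrable _ _)
      (q.continuous.intervalIntegrable _ _)
  map_smul' a p := by
    simp only [eval_smul, RingHom.id_apply, smul_eq_mul]
    exact intervalIntegral.integral_const_mul a _

namespace polyIntegral

open Polynomial

theorem apply_eq (p : ℝ[X]) : polyIntegral p = ∫ x in (0 : ℝ)..1, p.eval x := rfl

theorem C_mul (a : ℝ) (p : ℝ[X]) : polyIntegral (C a * p) = a * polyIntegral p := by
  rw [← smul_eq_C_mul, map_smul, smul_eq_mul]

theorem apply_derivative (p : ℝ[X]) : polyIntegral (derivative p) = p.eval 1 - p.eval 0 :=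
  intervalIntegral.integral_eq_sub_of_hasDerivAt (fun x _ => p.hasDerivAt x)
    ((derivative p).continuous.intervalIntegrable _ _)

theorem derivative_mul (p q : ℝ[X]) :
    polyIntegral (derivative p * q) =
      p.eval 1 * q.eval 1 - p.eval 0 * q.eval 0 - polyIntegral (p * derivative q) := by
  have h := apply_derivative (p * q)
  rw [Polynomial.derivative_mul, map_add, eval_mul, eval_mul] at h
  linarith

theorem X_pow (n : ℕ) : polyIntegral (X ^ n) = 1 / (n + 1) := by
  rw [apply_eq]
  simp

theorem mul_self_pos {p : ℝ[X]} (hp : p ≠ 0) : 0 < polyIntegral (p * p) := by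
  rw [apply_eq]
  obtain ⟨x, hx, hx0⟩ : ∃ x ∈ Set.Icc (0 : ℝ) 1, p.eval x ≠ 0 := by
    by_contra! h
    exact hp (Polynomial.eq_zero_of_infinite_isRoot p
      ((Set.Icc_infinite (zero_lt_one' ℝ)).mono fun x hx => h x hx))
  refine intervalIntegral.integral_pos zero_lt_one (p * p).continuous.continuousOn
    (fun y _ => ?_) ⟨x, hx, ?_⟩
  · rw [eval_mul]; exact mul_self_nonneg _
  · rw [eval_mul]; exact _root_.mul_self_pos.2 hx0

end polyIntegral

/-! ### Orthogonality, norms and zeros of the unnormalized Legendre polynomials. -/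

namespace Polynomial

/-- In the form on the right, the degree n enters a Legendre coefficient through a single binomial
coefficient, so relations between neighbouring degrees reduce to Pascal's rule. -/
theorem choose_mul_choose_add (n k : ℕ) :
    n.choose k * (n + k).choose n = (n + k).choose (2 * k) * k.centralBinom := by
  rcases lt_or_ge n k with h | h
  · rw [Nat.choose_eq_zero_of_lt h, Nat.choose_eq_zero_of_lt (by omega : n + k < 2 * k)]; simp
  · have h1 := Nat.choose_mul (n := n + k) (k := 2 * k) (s := k) (by omega)
    rw [Nat.centralBinom, h1, show n + k - k = n by omega, show 2 * k - k = k by omega,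
      Nat.choose_symm_add, mul_comm]

/-- This is the coefficient of x^k in L'ₙ₊₂ - L'ₙ = -2(2n+3) Lₙ₊₁, with the signs cleared so that it
lives in ℕ. -/
theorem shiftedLegendre_choose_identity (n k : ℕ) :
    (k + 1) * (((n + 2).choose (k + 1)) * (n + 2 + (k + 1)).choose (n + 2)) =
      (k + 1) * (n.choose (k + 1) * (n + (k + 1)).choose n) +
        2 * (2 * n + 3) * ((n + 1).choose k * (n + 1 + k).choose (n + 1)) := by
  rw [choose_mul_choose_add, choose_mul_choose_add, choose_mul_choose_add]
  have h1 := Nat.succ_mul_centralBinom_succ k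
  have h2 : (2 * k + 1) * (n + 2 + (k + 1)).choose (2 * (k + 1)) =
      (2 * k + 1) * (n + (k + 1)).choose (2 * (k + 1)) +
        (2 * n + 3) * (n + 1 + k).choose (2 * k) := by
    rw [show n + 2 + (k + 1) = (n + 1 + k) + 1 + 1 by ring, show n + (k + 1) = n + 1 + k by ring,
      show 2 * (k + 1) = 2 * k + 1 + 1 by ring, Nat.choose_succ_succ' _ (2 * k + 1),
      Nat.choose_succ_succ' _ (2 * k), Nat.choose_succ_succ' _ (2 * k + 1)]
    have h3 := Nat.choose_succ_right_eq (n + 1 + k) (2 * k)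
    rcases lt_or_ge (n + 1 + k) (2 * k) with h | h
    · rw [Nat.choose_eq_zero_of_lt h, Nat.choose_eq_zero_of_lt (by omega : n + 1 + k < 2 * k + 1),
        Nat.choose_eq_zero_of_lt (by omega : n + 1 + k < 2 * k + 1 + 1)]
      simp
    · obtain ⟨m, hm⟩ := Nat.exists_eq_add_of_le h
      rw [hm, Nat.add_sub_cancel_left] at h3
      rw [hm]
      have h4 : 2 * n + 3 = 2 * k + 2 * m + 1 := by omega
      rw [h4]
      linear_combination 2 * h3
  calc _ = ((k + 1) * (k + 1).centralBinom) * (n + 2 + (k + 1)).choose (2 * (k + 1)) := by ring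
    _ = 2 * k.centralBinom * ((2 * k + 1) * (n + 2 + (k + 1)).choose (2 * (k + 1))) := by
        rw [h1]; ring
    _ = (2 * (2 * k + 1) * k.centralBinom) * (n + (k + 1)).choose (2 * (k + 1)) +
        2 * (2 * n + 3) * ((n + 1 + k).choose (2 * k) * k.centralBinom) := by rw [h2]; ring
    _ = _ := by rw [← h1]; ring

/-- The shifted Legendre polynomials with real coefficients. -/
noncomputable def realLegendre (n : ℕ) : ℝ[X] := (shiftedLegendre n).map (Int.castRingHom ℝ)

theorem coeff_realLegendre (n k : ℕ) :
    (realLegendre n).coeff k = (-1) ^ k * (n.choose k * (n + k).choose n : ℕ) := by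
  simp [realLegendre, coeff_map, coeff_shiftedLegendre, mul_assoc]

theorem degree_realLegendre (n : ℕ) : (realLegendre n).degree = n := by
  rw [realLegendre, degree_map_eq_of_injective Int.cast_injective, degree_shiftedLegendre]

theorem realLegendre_ne_zero (n : ℕ) : realLegendre n ≠ 0 := by
  intro h; have := degree_realLegendre n; simp [h] at this

theorem derivative_realLegendre_sub (n : ℕ) :
    derivative (realLegendre (n + 2) - realLegendre n) =
      C (-(2 * (2 * (n : ℝ) + 3))) * realLegendre (n + 1) := by
  ext k
  rw [coeff_derivative, coeff_sub, coeff_C_mul, coeff_realLegendre, coeff_realLegendre,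
    coeff_realLegendre]
  have h := congrArg (Nat.cast : ℕ → ℝ) (shiftedLegendre_choose_identity n k)
  rw [pow_succ]
  push_cast at h ⊢
  linear_combination (-(-1 : ℝ) ^ k) * h

theorem eval_zero_realLegendre (n : ℕ) : (realLegendre n).eval 0 = 1 := by
  rw [← coeff_zero_eq_eval_zero, coeff_realLegendre]; simp

theorem eval_one_realLegendre (n : ℕ) : (realLegendre n).eval 1 = (-1) ^ n := by
  have h := shiftedLegendre_eval_symm n (1 : ℝ)
  have h0 := eval_zero_realLegendre n
  rw [realLegendre, eval_map] at h0 ⊢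
  simp only [aeval_def, sub_self] at h
  rw [show Int.castRingHom ℝ = algebraMap ℤ ℝ from rfl] at *
  rw [h, h0, mul_one]

/-- Up to a factor, Lₘ₊₁ is the derivative of Lₘ₊₂ - Lₘ, which vanishes at both endpoints.
Integration by parts therefore lowers the degree of q without boundary terms. The induction keeps n
free because it calls the indices m and m+2. -/
theorem polyIntegral_realLegendre_mul {n : ℕ} {q : ℝ[X]} (hq : q.degree < n) :
    polyIntegral (realLegendre n * q) = 0 := by
  suffices H : ∀ (d n : ℕ) (q : ℝ[X]), d ≤ n → q.degree < d →
      polyIntegral (realLegendre n * q) = 0 from H n n q le_rfl hq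
  clear hq n q
  intro d
  induction d with
  | zero =>
    intro n q _ hq
    have : q = 0 := by
      ext m
      exact (degree_lt_iff_coeff_zero q 0).1 hq m (Nat.zero_le m)
    simp [this]
  | succ d ih =>
    intro n q hn hq
    obtain ⟨m, rfl⟩ : ∃ m, n = m + 1 := ⟨n - 1, by omega⟩
    have hq' : (derivative q).degree < d := by
      rw [degree_lt_iff_coeff_zero] at hq ⊢
      intro k hk
      rw [coeff_derivative, hq (k + 1) (by omega), zero_mul]
    have h := polyIntegral.derivative_mul (realLegendre (m + 2) - realLegendre m) q
    rw [derivative_realLegendre_sub, mul_assoc, polyIntegral.C_mul, sub_mul, map_sub,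
      ih _ _ (by omega) hq', ih _ _ (by omega) hq'] at h
    simp only [eval_sub, eval_zero_realLegendre, eval_one_realLegendre] at h
    rw [pow_add] at h
    have h2 : -(2 * (2 * (m : ℝ) + 3)) ≠ 0 := by
      have : (0 : ℝ) ≤ m := m.cast_nonneg
      linarith
    apply mul_left_cancel₀ h2
    rw [h]; ring

/-- The derivative of xLₙ² is (2n+1)Lₙ² + 2Lₙ(xLₙ' - nLₙ). The last bracket has degree below n or is
zero, so orthogonality removes it and only Lₙ(1)² = 1 is left. -/
theorem polyIntegral_realLegendre_mul_self (n : ℕ) :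
    polyIntegral (realLegendre n * realLegendre n) = 1 / (2 * n + 1) := by
  have h := polyIntegral.apply_derivative (X * (realLegendre n * realLegendre n))
  have h1 : polyIntegral (realLegendre n *
      (X * derivative (realLegendre n) - C (n : ℝ) * realLegendre n)) = 0 := by
    apply polyIntegral_realLegendre_mul
    rw [degree_lt_iff_coeff_zero]
    intro k hk
    rw [coeff_sub, coeff_C_mul]
    rcases k with _ | k
    · obtain rfl : n = 0 := by omega
      simp
    · rw [coeff_X_mul, coeff_derivative]
      rcases hk.lt_or_eq with hk | hk
      · simp [coeff_realLegendre, Nat.choose_eq_zero_of_lt hk]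
      · rw [hk]; push_cast; ring
  have h2 : derivative (X * (realLegendre n * realLegendre n)) =
      C (2 * (n : ℝ) + 1) * (realLegendre n * realLegendre n) + C 2 * (realLegendre n *
      (X * derivative (realLegendre n) - C (n : ℝ) * realLegendre n)) := by
    simp only [derivative_mul, derivative_X, map_add, map_mul, map_one,
      show (C 2 : ℝ[X]) = 2 from rfl]
    ring
  rw [h2, map_add, polyIntegral.C_mul, polyIntegral.C_mul, h1] at h
  simp only [eval_mul, eval_X, eval_one_realLegendre, ← mul_pow] at h
  have h3 : (0 : ℝ) < 2 * n + 1 := by positivity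
  rw [eq_div_iff h3.ne']
  norm_num at h
  linarith

theorem card_roots_le_iterate_derivative (p : ℝ[X]) (k : ℕ) :
    p.roots.card ≤ (derivative^[k] p).roots.card + k := by
  induction k with
  | zero => simp
  | succ k ih =>
    rw [Function.iterate_succ_apply']
    have := card_roots_le_derivative (derivative^[k] p)
    omega

/-- By Rodrigues' formula n! Lₙ is the n-th derivative of xⁿ(1-x)ⁿ, which has 2n roots with
multiplicity, and by Rolle each derivative loses at most one. -/
theorem card_roots_realLegendre (n : ℕ) : (realLegendre n).roots.card = n := by
  apply le_antisymm
  · have := card_roots' (realLegendre n)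
    rwa [natDegree_eq_of_degree_eq_some (degree_realLegendre n)] at this
  · have h := congrArg (Polynomial.map (Int.castRingHom ℝ)) (factorial_mul_shiftedLegendre_eq n)
    rw [Polynomial.map_mul, ← iterate_derivative_map] at h
    have h1 : (X ^ n * (1 - X) ^ n : ℤ[X]).map (Int.castRingHom ℝ) =
        C ((-1) ^ n) * (X ^ n * (X - C 1) ^ n) := by
      simp only [Polynomial.map_mul, Polynomial.map_pow, map_X, Polynomial.map_sub,
        Polynomial.map_one, map_pow, map_neg, map_one]
      rw [← mul_pow, ← mul_pow, ← mul_pow]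
      ring
    have h2 : (X ^ n * (X - C 1) ^ n : ℝ[X]) ≠ 0 :=
      mul_ne_zero (pow_ne_zero _ X_ne_zero) (pow_ne_zero _ (X_sub_C_ne_zero 1))
    have h3 := card_roots_le_iterate_derivative
      ((X ^ n * (1 - X) ^ n : ℤ[X]).map (Int.castRingHom ℝ)) n
    rw [← h, h1, roots_C_mul _ (by simp), roots_mul h2, roots_pow, roots_pow, roots_X,
      roots_X_sub_C, Polynomial.map_natCast, ← C_eq_natCast,
      roots_C_mul _ (by exact_mod_cast n.factorial_ne_zero)] at h3
    simp at h3
    exact h3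

/-- If Lₙ = (X-a)²q, then Lₙ is orthogonal to q, yet ∫ Lₙq = ∫ ((X-a)q)² > 0. -/
theorem nodup_roots_realLegendre (n : ℕ) : (realLegendre n).roots.Nodup := by
  rw [Multiset.nodup_iff_count_le_one]
  intro a
  rw [count_roots]
  by_contra! h
  obtain ⟨q, hq⟩ := (le_rootMultiplicity_iff (realLegendre_ne_zero n)).1 h
  have hq0 : q ≠ 0 := by
    rintro rfl; exact realLegendre_ne_zero n (by rw [hq, mul_zero])
  have hdeg : q.degree < n := by
    have h1 := degree_realLegendre n
    rw [hq, degree_mul, degree_pow, degree_X_sub_C, degree_eq_natDegree hq0] at h1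
    rw [degree_eq_natDegree hq0]
    have h2 : 2 + q.natDegree = n := by
      rw [nsmul_one] at h1
      exact_mod_cast h1
    exact_mod_cast (by omega : q.natDegree < n)
  have h1 := polyIntegral_realLegendre_mul hdeg
  have h2 : realLegendre n * q = ((X - C a) * q) * ((X - C a) * q) := by rw [hq]; ring
  rw [h2] at h1
  exact (polyIntegral.mul_self_pos (mul_ne_zero (X_sub_C_ne_zero a) hq0)).ne' h1

end Polynomial

/-! ### Integration in the orthonormal Legendre basis. -/

open Polynomial in
theorem legendrePoly_eq (n : ℕ) :
    legendrePoly n = C (Real.sqrt (2 * n + 1) * (-1) ^ n) * realLegendre n := rfl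

theorem sqrt_two_mul_add_one_ne_zero (n : ℕ) : Real.sqrt (2 * n + 1) ≠ 0 :=
  (Real.sqrt_pos.2 (by positivity)).ne'

theorem legendrePoly_factor_ne_zero (n : ℕ) : Real.sqrt (2 * n + 1) * (-1) ^ n ≠ 0 :=
  mul_ne_zero (sqrt_two_mul_add_one_ne_zero n) (by simp)

theorem degree_legendrePoly (n : ℕ) : (legendrePoly n).degree = n := by
  rw [legendrePoly_eq, Polynomial.degree_C_mul (legendrePoly_factor_ne_zero n),
    Polynomial.degree_realLegendre]

theorem polyIntegral_legendrePoly_mul_of_degree_lt {n : ℕ} {q : Polynomial ℝ} (hq : q.degree < n) :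
    polyIntegral (legendrePoly n * q) = 0 := by
  rw [legendrePoly_eq, mul_assoc, polyIntegral.C_mul,
    Polynomial.polyIntegral_realLegendre_mul hq, mul_zero]

theorem polyIntegral_legendrePoly_mul (i j : ℕ) :
    polyIntegral (legendrePoly i * legendrePoly j) = if i = j then 1 else 0 := by
  rcases lt_trichotomy i j with h | rfl | h
  · rw [mul_comm, polyIntegral_legendrePoly_mul_of_degree_lt, if_neg h.ne]
    rw [degree_legendrePoly]; exact_mod_cast h
  · rw [if_pos rfl, legendrePoly_eq, mul_mul_mul_comm, ← Polynomial.C_mul, polyIntegral.C_mul,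
      Polynomial.polyIntegral_realLegendre_mul_self, mul_mul_mul_comm,
      Real.mul_self_sqrt (by positivity), ← mul_pow]
    have : (2 * (i : ℝ) + 1) ≠ 0 := by positivity
    norm_num
    field_simp
  · rw [polyIntegral_legendrePoly_mul_of_degree_lt, if_neg h.ne']
    rw [degree_legendrePoly]; exact_mod_cast h

theorem xi_succ (n : ℕ) :
    xi (n + 1) = 1 / (2 * (Real.sqrt (2 * (n + 1 : ℕ) + 1) * Real.sqrt (2 * n + 1))) := by
  rw [xi, ← Real.sqrt_mul (by positivity)]
  congr 4
  push_cast
  ring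

theorem xi_mul_legendrePoly_sub (n : ℕ) :
    Polynomial.C (xi (n + 2)) * legendrePoly (n + 2) - Polynomial.C (xi (n + 1)) * legendrePoly n =
      Polynomial.C ((-1) ^ n / (2 * Real.sqrt (2 * (n + 1 : ℕ) + 1))) *
        (Polynomial.realLegendre (n + 2) - Polynomial.realLegendre n) := by
  rw [legendrePoly_eq, legendrePoly_eq, ← mul_assoc, ← mul_assoc, ← Polynomial.C_mul,
    ← Polynomial.C_mul, mul_sub]
  have h0 := sqrt_two_mul_add_one_ne_zero n
  have h1 := sqrt_two_mul_add_one_ne_zero (n + 1)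
  have h2 := sqrt_two_mul_add_one_ne_zero (n + 2)
  congr 3
  · rw [show n + 2 = n + 1 + 1 from rfl, xi_succ] at *
    field_simp
    ring
  · rw [xi_succ]
    field_simp

/-- The two coefficients are the entries of column n+1 of X_s: the column lists the Legendre
coefficients of an antiderivative. -/
theorem derivative_xi_mul_legendrePoly_sub (n : ℕ) :
    Polynomial.derivative (Polynomial.C (xi (n + 2)) * legendrePoly (n + 2) -
      Polynomial.C (xi (n + 1)) * legendrePoly n) = legendrePoly (n + 1) := by
  rw [xi_mul_legendrePoly_sub, Polynomial.derivative_C_mul,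
    Polynomial.derivative_realLegendre_sub, ← mul_assoc, ← Polynomial.C_mul, legendrePoly_eq]
  congr 2
  have h1 := sqrt_two_mul_add_one_ne_zero (n + 1)
  have h2 := Real.mul_self_sqrt (show (0 : ℝ) ≤ 2 * (n + 1 : ℕ) + 1 by positivity)
  field_simp
  rw [pow_two, h2]
  push_cast
  ring

open Polynomial in
/-- The Legendre coefficients of `q` in terms of those of its derivative. -/
theorem polyIntegral_legendrePoly_succ_mul (n : ℕ) (q : ℝ[X]) :
    polyIntegral (legendrePoly (n + 1) * q) =
      xi (n + 1) * polyIntegral (legendrePoly n * derivative q) -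
        xi (n + 2) * polyIntegral (legendrePoly (n + 2) * derivative q) := by
  rw [← derivative_xi_mul_legendrePoly_sub n, polyIntegral.derivative_mul, sub_mul, map_sub,
    mul_assoc, mul_assoc, polyIntegral.C_mul, polyIntegral.C_mul]
  have h : ∀ x : ℝ, (realLegendre (n + 2) - realLegendre n).eval x = 0 →
      (C (xi (n + 2)) * legendrePoly (n + 2) - C (xi (n + 1)) * legendrePoly n).eval x = 0 := by
    intro x hx
    rw [xi_mul_legendrePoly_sub, eval_mul, hx, mul_zero]
  rw [h 1, h 0]
  · ring
  · simp [eval_zero_realLegendre]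
  · simp [eval_one_realLegendre, pow_add]

theorem legendrePoly_zero : legendrePoly 0 = 1 := by
  ext k
  rw [legendrePoly_eq, Polynomial.coeff_C_mul, Polynomial.coeff_realLegendre]
  rcases k with _ | k <;> simp [Polynomial.coeff_one]

open Polynomial in
theorem xi_one_mul_legendrePoly_one : C (xi 1) * legendrePoly 1 = X - C (1 / 2) := by
  ext k
  have h0 := sqrt_two_mul_add_one_ne_zero 0
  have h1 := sqrt_two_mul_add_one_ne_zero 1
  rw [legendrePoly_eq, coeff_C_mul, coeff_C_mul, coeff_realLegendre, xi_succ 0]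
  rcases k with _ | _ | k
  · simp at *
    field_simp
  · simp at *
    field_simp
  · simp [coeff_X, Nat.choose_eq_zero_of_lt (show 1 < k + 1 + 1 by omega)]

-- This is the top row of X_s. Integration by parts against x - 1/2 = ξ₁P₁ (P₁ of degree 1) leaves
-- boundary terms here, which is why q must vanish at 0.
open Polynomial in
theorem polyIntegral_legendrePoly_zero_mul (q : ℝ[X]) (hq : q.eval 0 = 0) :
    polyIntegral (legendrePoly 0 * q) =
      1 / 2 * polyIntegral (legendrePoly 0 * derivative q) -
        xi 1 * polyIntegral (legendrePoly 1 * derivative q) := by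
  have h := polyIntegral.derivative_mul (X - C (1 / 2)) q
  rw [← polyIntegral.C_mul (xi 1), ← mul_assoc, xi_one_mul_legendrePoly_one, legendrePoly_zero]
  have h1 := polyIntegral.apply_derivative q
  simp [hq] at h h1 ⊢
  rw [h, h1]
  ring

/-! ### Gauss–Legendre quadrature -/

theorem roots_legendrePoly (s : ℕ) :
    (legendrePoly s).roots = (Polynomial.realLegendre s).roots := by
  rw [legendrePoly_eq, Polynomial.roots_C_mul _ (legendrePoly_factor_ne_zero s)]

theorem length_sort_roots_legendrePoly (s : ℕ) :
    ((legendrePoly s).roots.sort (· ≤ ·)).length = s := by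
  rw [Multiset.length_sort, roots_legendrePoly, Polynomial.card_roots_realLegendre]

theorem gaussNode_eq_getElem (s : ℕ) (i : Fin s) :
    gaussNode s i = ((legendrePoly s).roots.sort (· ≤ ·))[(i : ℕ)]'
      (by rw [length_sort_roots_legendrePoly]; exact i.2) :=
  List.getD_eq_getElem _ _ _

theorem gaussNode_injective (s : ℕ) : Function.Injective (gaussNode s) := by
  intro i j h
  rw [gaussNode_eq_getElem, gaussNode_eq_getElem] at h
  have hn : ((legendrePoly s).roots.sort (· ≤ ·)).Nodup := by
    rw [← Multiset.coe_nodup, Multiset.sort_eq, roots_legendrePoly]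
    exact Polynomial.nodup_roots_realLegendre s
  exact Fin.ext (hn.getElem_inj_iff.1 h)

theorem eval_gaussNode_legendrePoly (s : ℕ) (i : Fin s) :
    (legendrePoly s).eval (gaussNode s i) = 0 := by
  have h : gaussNode s i ∈ (legendrePoly s).roots := by
    rw [← Multiset.mem_sort (r := (· ≤ ·)), gaussNode_eq_getElem]
    exact List.getElem_mem _
  exact (Polynomial.mem_roots'.1 h).2

open Polynomial in
/-- The Gauss–Legendre formula with `s` nodes is exact in degree less than `2 * s`. -/
theorem sum_gaussWeight_mul_eval (s : ℕ) {q : ℝ[X]} (hq : q.degree < (2 * s : ℕ)) :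
    ∑ i, gaussWeight s i * q.eval (gaussNode s i) = polyIntegral q := by
  have hP0 : realLegendre s ≠ 0 := realLegendre_ne_zero s
  have hPs : legendrePoly s ≠ 0 := by
    rw [legendrePoly_eq]
    exact mul_ne_zero (C_ne_zero.2 (legendrePoly_factor_ne_zero s)) hP0
  have hdiv := EuclideanDomain.div_add_mod q (legendrePoly s)
  have hmod : (q % legendrePoly s).degree < s := by
    have := EuclideanDomain.mod_lt q hPs
    rwa [← degree_legendrePoly s]
  have hquo : (q / legendrePoly s).degree < s := by
    by_cases h0 : q / legendrePoly s = 0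
    · rw [h0, degree_zero]; exact WithBot.bot_lt_coe _
    · have h1 : s + (q / legendrePoly s).degree ≤ q.degree := by
        rw [← degree_legendrePoly s]
        refine degree_add_div hPs ?_ |>.le
        by_contra! hlt
        exact h0 ((Polynomial.div_eq_zero_iff hPs).2 hlt)
      have h2 := h1.trans_lt hq
      rw [degree_eq_natDegree h0] at h2 ⊢
      have h3 : s + (q / legendrePoly s).natDegree < 2 * s := by exact_mod_cast h2
      exact_mod_cast (by omega : (q / legendrePoly s).natDegree < s)
  -- The multiple of the Legendre polynomial drops out of the integral by orthogonality and out of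
  -- the sum because the nodes are its zeros. The remainder is interpolated exactly.
  have hI : polyIntegral q = polyIntegral (q % legendrePoly s) := by
    rw [← hdiv, map_add, polyIntegral_legendrePoly_mul_of_degree_lt hquo, zero_add, hdiv]
  have he : ∀ i, q.eval (gaussNode s i) = (q % legendrePoly s).eval (gaussNode s i) := by
    intro i
    conv_lhs => rw [← hdiv]
    rw [eval_add, eval_mul, eval_gaussNode_legendrePoly, zero_mul, zero_add]
  have hint := Lagrange.eq_interpolate (s := Finset.univ) (v := gaussNode s)
    (f := q % legendrePoly s) (gaussNode_injective s).injOn (by simpa using hmod)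
  rw [hI]
  conv_rhs => rw [hint]
  rw [Lagrange.interpolate_apply, map_sum]
  refine Finset.sum_congr rfl fun i _ => ?_
  rw [polyIntegral.C_mul, he, mul_comm]
  rfl

-- Exactness applies to the square of the i-th Lagrange polynomial, of degree 2(s-1), and identifies
-- the weight with the integral of that square.
open Polynomial in
theorem gaussWeight_pos (s : ℕ) (i : Fin s) : 0 < gaussWeight s i := by
  have hinj := (gaussNode_injective s).injOn (s := (Finset.univ : Finset (Fin s)))
  set ℓ := Lagrange.basis Finset.univ (gaussNode s) i with hℓ
  have hd : (ℓ * ℓ).degree < (2 * s : ℕ) := by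
    rw [degree_mul, Lagrange.degree_basis hinj (Finset.mem_univ i)]
    have := i.2
    simp only [Finset.card_univ, Fintype.card_fin]
    exact_mod_cast (by omega : s - 1 + (s - 1) < 2 * s)
  have h := sum_gaussWeight_mul_eval s hd
  rw [Finset.sum_eq_single i] at h
  · rw [eval_mul, Lagrange.eval_basis_self hinj (Finset.mem_univ i), mul_one, mul_one] at h
    rw [h]
    exact polyIntegral.mul_self_pos (Lagrange.basis_ne_zero hinj (Finset.mem_univ i))
  · intro j _ hj
    rw [eval_mul, Lagrange.eval_basis_of_ne (Ne.symm hj) (Finset.mem_univ j), mul_zero, mul_zero]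
  · simp

/-- Products of basis polynomials have degree at most 2s-2, so orthonormality survives the
quadrature. -/
theorem legendreMatrix_transpose_mul (s : ℕ) :
    (legendreMatrix s).transpose * Matrix.diagonal (gaussWeight s) * legendreMatrix s = 1 := by
  ext k l
  rw [Matrix.mul_apply]
  simp only [Matrix.mul_diagonal, Matrix.transpose_apply, legendreMatrix, Matrix.of_apply]
  have hd : (legendrePoly k * legendrePoly l).degree < (2 * s : ℕ) := by
    rw [Polynomial.degree_mul, degree_legendrePoly, degree_legendrePoly]
    exact_mod_cast (by omega : (k : ℕ) + l < 2 * s)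
  have h := sum_gaussWeight_mul_eval s hd
  rw [polyIntegral_legendrePoly_mul] at h
  rw [Matrix.one_apply]
  simp only [Fin.ext_iff]
  rw [← h]
  refine Finset.sum_congr rfl fun i _ => ?_
  rw [Polynomial.eval_mul]
  ring

theorem inv_legendreMatrix (s : ℕ) :
    (legendreMatrix s)⁻¹ = (legendreMatrix s).transpose * Matrix.diagonal (gaussWeight s) :=
  Matrix.inv_eq_left_inv (legendreMatrix_transpose_mul s)

theorem legendreMatrix_mul_inv (s : ℕ) :
    legendreMatrix s * ((legendreMatrix s).transpose * Matrix.diagonal (gaussWeight s)) = 1 :=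
  mul_eq_one_comm.1 (legendreMatrix_transpose_mul s)

/-! ### Simplifying assumptions for the perturbed Gauss methods -/

namespace ButcherTableau

variable {s : ℕ}

/-- The algebraic criterion for symplecticity: `bᵢ aᵢⱼ + bⱼ aⱼᵢ = bᵢ bⱼ`. -/
def SatisfiesSymplecticIdentity (M : ButcherTableau s) : Prop :=
  ∀ i j, M.b i * M.A i j + M.b j * M.A j i = M.b i * M.b j

/-- The quadrature condition `B(p)`: the weights and abscissae integrate `τ ^ m` exactly for
`m < p`. -/
def QuadratureOrder (M : ButcherTableau s) (p : ℕ) : Prop :=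
  ∀ m < p, ∑ i, M.b i * M.c i ^ m = 1 / ((m : ℝ) + 1)

/-- The simplifying assumption `C(η)`: the rows of the matrix integrate `τ ^ m` exactly for
`m < η`. -/
def StageOrder (M : ButcherTableau s) (η : ℕ) : Prop :=
  ∀ m < η, ∀ i, ∑ j, M.A i j * M.c j ^ m = M.c i ^ (m + 1) / ((m : ℝ) + 1)

end ButcherTableau

-- Degree s is admitted, one more than interpolation allows, since the product still has degree at
-- most 2s-1. Antiderivatives of polynomials of degree s-1 need this.
open Matrix in
theorem transpose_legendreMatrix_mulVec (s : ℕ) {p : Polynomial ℝ} (hp : p.degree < (s + 1 : ℕ))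
    (l : Fin s) :
    (((legendreMatrix s).transpose * Matrix.diagonal (gaussWeight s)) *ᵥ
      fun i => p.eval (gaussNode s i)) l = polyIntegral (legendrePoly l * p) := by
  have hd : (legendrePoly l * p).degree < (2 * s : ℕ) := by
    by_cases h0 : p = 0
    · rw [h0, mul_zero, Polynomial.degree_zero]; exact WithBot.bot_lt_coe _
    rw [Polynomial.degree_mul, degree_legendrePoly]
    rw [Polynomial.degree_eq_natDegree h0] at hp ⊢
    have h1 : p.natDegree < s + 1 := by exact_mod_cast hp
    exact_mod_cast (by omega : (l : ℕ) + p.natDegree < 2 * s)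
  rw [← sum_gaussWeight_mul_eval s hd]
  simp only [mulVec, dotProduct, mul_diagonal, transpose_apply, legendreMatrix, of_apply,
    Polynomial.eval_mul]
  exact Finset.sum_congr rfl fun i _ => by ring

theorem gaussX_eq_zero_row (s : ℕ) (k l : Fin s) (hk : (k : ℕ) = 0) :
    gaussX s k l = (if (l : ℕ) = 0 then 1 / 2 else 0) + (if (l : ℕ) = 1 then -xi 1 else 0) := by
  simp only [gaussX, Matrix.of_apply, hk]
  by_cases h0 : (l : ℕ) = 0
  · simp [h0]
  · by_cases h1 : (l : ℕ) = 1
    · simp [h1]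
    · simp [h0, h1]

theorem gaussX_eq_succ_row (s n : ℕ) (k l : Fin s) (hk : (k : ℕ) = n + 1) :
    gaussX s k l =
      (if (l : ℕ) = n then xi (n + 1) else 0) + (if (l : ℕ) = n + 2 then -xi (n + 2) else 0) := by
  simp only [gaussX, Matrix.of_apply, hk]
  by_cases h0 : (l : ℕ) = n
  · simp [h0]
  · by_cases h1 : (l : ℕ) = n + 2
    · simp [h1]
    · simp [h0, h1, Ne.symm h0]

/-- The hypothesis `hf` covers the neighbour missing from the last row of the truncated X_s: its
entry would multiply a zero coefficient. -/
theorem sum_ite_val_eq_mul {s : ℕ} (n : ℕ) (a : ℝ) (f : ℕ → ℝ) (hf : ∀ l, s ≤ l → f l = 0) :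
    ∑ l : Fin s, (if (l : ℕ) = n then a else 0) * f l = a * f n := by
  rw [Fin.sum_univ_eq_sum_range (fun l => (if l = n then a else 0) * f l) s]
  by_cases hn : n < s
  · rw [Finset.sum_eq_single n]
    · simp
    · intro b _ hb; simp [hb]
    · intro h; simp at h; omega
  · rw [hf n (by omega), mul_zero]
    refine Finset.sum_eq_zero fun l hl => ?_
    rw [Finset.mem_range] at hl
    rw [if_neg (by omega), zero_mul]

-- The Gauss matrix integrates: it sends the node values of q' to those of q. One passes to Legendre
-- coefficients by quadrature, where X_s encodes integration, and returns to node values.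
open Matrix Polynomial in
theorem legendreMatrix_mul_gaussX_mulVec (s : ℕ) {q : ℝ[X]} (hq0 : q.eval 0 = 0)
    (hq : (derivative q).degree < s) (hqs : q.degree < (s + 1 : ℕ)) (i : Fin s) :
    ((legendreMatrix s * gaussX s *
      ((legendreMatrix s).transpose * Matrix.diagonal (gaussWeight s))) *ᵥ
      fun i => (derivative q).eval (gaussNode s i)) i = q.eval (gaussNode s i) := by
  have hlt : (derivative q).degree < (s + 1 : ℕ) :=
    hq.trans (by exact_mod_cast Nat.lt_succ_self s)
  have key : gaussX s *ᵥ (((legendreMatrix s).transpose * Matrix.diagonal (gaussWeight s)) *ᵥ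
        fun i => (derivative q).eval (gaussNode s i)) =
      ((legendreMatrix s).transpose * Matrix.diagonal (gaussWeight s)) *ᵥ
        fun i => q.eval (gaussNode s i) := by
    ext k
    rw [transpose_legendreMatrix_mulVec s hqs]
    have hz : ∀ l, s ≤ l → polyIntegral (legendrePoly l * derivative q) = 0 := fun l hl =>
      polyIntegral_legendrePoly_mul_of_degree_lt (hq.trans_le (by exact_mod_cast hl))
    rw [mulVec, dotProduct]
    simp only [transpose_legendreMatrix_mulVec s hlt]
    rcases hk : (k : ℕ) with _ | n
    · rw [polyIntegral_legendrePoly_zero_mul q hq0]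
      simp only [gaussX_eq_zero_row s k _ hk, add_mul]
      rw [Finset.sum_add_distrib, sum_ite_val_eq_mul 0 _ _ hz, sum_ite_val_eq_mul 1 _ _ hz]
      ring
    · rw [polyIntegral_legendrePoly_succ_mul n q]
      simp only [gaussX_eq_succ_row s n k _ hk, add_mul]
      rw [Finset.sum_add_distrib, sum_ite_val_eq_mul n _ _ hz, sum_ite_val_eq_mul (n + 2) _ _ hz]
      ring
  rw [← mulVec_mulVec, ← mulVec_mulVec, key, mulVec_mulVec, legendreMatrix_mul_inv, one_mulVec]

open Matrix in
theorem gaussX_add_transpose (s : ℕ) (k l : Fin s) :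
    gaussX s k l + gaussX s l k = if (k : ℕ) = 0 ∧ (l : ℕ) = 0 then 1 else 0 := by
  simp only [gaussX, Matrix.of_apply]
  split_ifs <;> first | omega | norm_num

section Perturbed

variable (s r : ℕ) (V : Matrix (Fin (r + 1)) (Fin (r + 1)) ℝ)

theorem cornerMatrix_add_transpose (hV : V.transpose = -V) (k l : Fin s) :
    cornerMatrix s r V k l + cornerMatrix s r V l k = 0 := by
  have h : ∀ i j, V i j + V j i = 0 := by
    intro i j
    have := congrFun (congrFun hV i) j
    rw [Matrix.transpose_apply, Matrix.neg_apply] at this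
    linarith
  simp only [cornerMatrix, Matrix.of_apply]
  split_ifs <;> first | omega | simp | skip
  exact h _ _

theorem perturbedGauss_A_eq : (perturbedGauss s r V).A =
    legendreMatrix s * (gaussX s + cornerMatrix s r V) *
      ((legendreMatrix s).transpose * Matrix.diagonal (gaussWeight s)) := by
  rw [← inv_legendreMatrix]; rfl

/-- Since bᵢaᵢⱼ = bᵢbⱼ(PYPᵀ)ᵢⱼ, the left side is bᵢbⱼ(P(Y+Yᵀ)Pᵀ)ᵢⱼ. The matrix Y+Yᵀ is the unit at
the top-left corner, and the first column of P is constant 1. -/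
theorem perturbedGauss_symplecticIdentity (hs : 0 < s) (hV : V.transpose = -V) :
    (perturbedGauss s r V).SatisfiesSymplecticIdentity := by
  intro i j
  set Y := gaussX s + cornerMatrix s r V with hY
  have hYY : ∀ k l, Y k l + Y l k = if (k : ℕ) = 0 ∧ (l : ℕ) = 0 then 1 else 0 := by
    intro k l
    have h1 := gaussX_add_transpose s k l
    have h2 := cornerMatrix_add_transpose s r V hV k l
    simp only [hY, Matrix.add_apply]
    rw [← h1]; linarith
  have hA : ∀ i j, (perturbedGauss s r V).A i j =
      (∑ k, ∑ l, legendreMatrix s i k * Y k l * legendreMatrix s j l) * gaussWeight s j := by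
    intro i j
    rw [perturbedGauss_A_eq, ← Matrix.mul_assoc, Matrix.mul_diagonal, Matrix.mul_apply]
    congr 1
    rw [Finset.sum_comm]
    refine Finset.sum_congr rfl fun l _ => ?_
    rw [Matrix.mul_apply, Finset.sum_mul]
    rfl
  have hb : ∀ i, (perturbedGauss s r V).b i = gaussWeight s i := fun _ => rfl
  rw [hA, hA, hb, hb]
  have hsum : (∑ k, ∑ l, legendreMatrix s i k * Y k l * legendreMatrix s j l) +
      (∑ k, ∑ l, legendreMatrix s j k * Y k l * legendreMatrix s i l) = 1 := by
    rw [Finset.sum_comm (f := fun k l => legendreMatrix s j k * Y k l * legendreMatrix s i l),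
      ← Finset.sum_add_distrib]
    simp only [← Finset.sum_add_distrib]
    have h0 : ∀ i, legendreMatrix s i ⟨0, hs⟩ = 1 := by
      intro i
      simp [legendreMatrix, legendrePoly_zero]
    have hterm : ∀ k l, legendreMatrix s i k * Y k l * legendreMatrix s j l +
        legendreMatrix s j l * Y l k * legendreMatrix s i k =
        if k = ⟨0, hs⟩ then (if l = ⟨0, hs⟩ then 1 else 0) else 0 := by
      intro k l
      have : legendreMatrix s i k * Y k l * legendreMatrix s j l +
        legendreMatrix s j l * Y l k * legendreMatrix s i k =
        legendreMatrix s i k * legendreMatrix s j l * (Y k l + Y l k) := by ring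
      rw [this, hYY]
      by_cases hk : k = ⟨0, hs⟩
      · by_cases hl : l = ⟨0, hs⟩
        · subst hk hl; simp [h0]
        · rw [if_pos hk, if_neg hl, if_neg (fun h => hl (Fin.ext h.2)), mul_zero]
      · rw [if_neg hk, if_neg (fun h => hk (Fin.ext h.1)), mul_zero]
    simp [hterm]
  linear_combination (gaussWeight s i * gaussWeight s j) * hsum

theorem perturbedGauss_quadratureOrder : (perturbedGauss s r V).QuadratureOrder (2 * s) := by
  intro m hm
  have h := sum_gaussWeight_mul_eval s (q := Polynomial.X ^ m)
    (by rw [Polynomial.degree_X_pow]; exact_mod_cast hm)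
  rw [polyIntegral.X_pow] at h
  simp only [Polynomial.eval_pow, Polynomial.eval_X] at h
  exact h

open Matrix Polynomial in
/-- The defect of the stage quadrature of the perturbed method on monomials comes from the corner
matrix only. -/
theorem sum_perturbedGauss_A_mul_pow {m : ℕ} (hm : m < s) (i : Fin s) :
    ∑ j, (perturbedGauss s r V).A i j * gaussNode s j ^ m =
      gaussNode s i ^ (m + 1) / (m + 1) +
        (legendreMatrix s *ᵥ (cornerMatrix s r V *ᵥ
          fun l : Fin s => polyIntegral (legendrePoly l * X ^ m))) i := by
  have hm1 : ((m : ℝ) + 1) ≠ 0 := by positivity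
  have hder : derivative (C (1 / ((m : ℝ) + 1)) * X ^ (m + 1)) = X ^ m := by
    rw [derivative_C_mul, derivative_X_pow, ← mul_assoc, ← C_mul]
    push_cast
    rw [one_div_mul_cancel hm1, C_1, one_mul]
  have h := legendreMatrix_mul_gaussX_mulVec s
    (q := C (1 / ((m : ℝ) + 1)) * X ^ (m + 1)) (by simp)
    (by rw [hder, degree_X_pow]; exact_mod_cast hm)
    (by
      refine (degree_C_mul_X_pow_le _ _).trans_lt ?_
      exact_mod_cast (by omega : m + 1 < s + 1)) i
  rw [hder] at h
  have hv : (fun l : Fin s => polyIntegral (legendrePoly l * X ^ m)) =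
      ((legendreMatrix s).transpose * Matrix.diagonal (gaussWeight s)) *ᵥ
        fun i => ((X : ℝ[X]) ^ m).eval (gaussNode s i) := by
    ext l
    rw [transpose_legendreMatrix_mulVec s]
    rw [degree_X_pow]; exact_mod_cast (by omega : m < s + 1)
  have h2 : ∑ j, (perturbedGauss s r V).A i j * gaussNode s j ^ m =
      ((perturbedGauss s r V).A *ᵥ fun i => ((X : ℝ[X]) ^ m).eval (gaussNode s i)) i := by
    simp [mulVec, dotProduct]
  rw [h2, perturbedGauss_A_eq, mul_add, add_mul, add_mulVec, Pi.add_apply, h, hv,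
    mulVec_mulVec, mulVec_mulVec, ← mul_assoc]
  simp
  ring

theorem cornerMatrix_mulVec_eq_zero (f : Fin s → ℝ)
    (hf : ∀ l : Fin s, s - (r + 1) ≤ (l : ℕ) → f l = 0) :
    (cornerMatrix s r V).mulVec f = 0 := by
  ext k
  rw [Matrix.mulVec, dotProduct]
  refine Finset.sum_eq_zero fun l _ => ?_
  by_cases hl : s - (r + 1) ≤ (l : ℕ)
  · rw [hf l hl, mul_zero]
  · rw [cornerMatrix, Matrix.of_apply, if_neg (fun h => hl h.2), zero_mul]

theorem polyIntegral_legendrePoly_mul_X_pow {m l : ℕ} (h : m < l) :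
    polyIntegral (legendrePoly l * Polynomial.X ^ m) = 0 :=
  polyIntegral_legendrePoly_mul_of_degree_lt
    (by rw [Polynomial.degree_X_pow]; exact_mod_cast h)

/-- For m below s-(r+1), x^m has no Legendre coefficients in the range where the corner matrix acts.
-/
theorem perturbedGauss_stageOrder : (perturbedGauss s r V).StageOrder (s - (r + 1)) := by
  intro m hm i
  have h := sum_perturbedGauss_A_mul_pow s r V (m := m) (by omega) i
  rw [cornerMatrix_mulVec_eq_zero s r V _ fun l hl =>
    polyIntegral_legendrePoly_mul_X_pow (by omega), Matrix.mulVec_zero, Pi.zero_apply,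
    add_zero] at h
  exact h

theorem polyIntegral_legendrePoly_mul_X_pow_self_ne_zero (n : ℕ) :
    polyIntegral (legendrePoly n * Polynomial.X ^ n) ≠ 0 := by
  intro h
  have h1 := polyIntegral_legendrePoly_mul n n
  rw [if_pos rfl] at h1
  have h2 : polyIntegral (legendrePoly n * (legendrePoly n -
      Polynomial.C ((legendrePoly n).coeff n) * Polynomial.X ^ n)) = 0 := by
    apply polyIntegral_legendrePoly_mul_of_degree_lt
    rw [Polynomial.degree_lt_iff_coeff_zero]
    intro k hk
    rw [Polynomial.coeff_sub, Polynomial.coeff_C_mul, Polynomial.coeff_X_pow]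
    rcases hk.lt_or_eq with hk | hk
    · rw [if_neg (by omega), mul_zero, sub_zero]
      exact Polynomial.coeff_eq_zero_of_degree_lt
        (by rw [degree_legendrePoly]; exact_mod_cast hk)
    · rw [hk]; simp
  rw [mul_sub, map_sub, h1, mul_left_comm, polyIntegral.C_mul, h] at h2
  simp at h2

/-- If the perturbed method has stage order exceeding the size of the unperturbed block, then the
first column of the perturbation vanishes. -/
theorem first_column_eq_zero (hr : r + 1 < s)
    (h : ∀ i, ∑ j, (perturbedGauss s r V).A i j * gaussNode s j ^ (s - (r + 1)) =
      gaussNode s i ^ (s - (r + 1) + 1) / ((s - (r + 1) : ℕ) + 1)) (i : Fin (r + 1)) :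
    V i 0 = 0 := by
  set η := s - (r + 1) with hη
  set v : Fin s → ℝ := fun l => polyIntegral (legendrePoly l * Polynomial.X ^ η) with hv
  have h1 : (legendreMatrix s).mulVec ((cornerMatrix s r V).mulVec v) = 0 := by
    ext i
    have h2 := sum_perturbedGauss_A_mul_pow s r V (m := η) (by omega) i
    rw [h i] at h2
    rw [Pi.zero_apply]
    linarith
  have h2 : (cornerMatrix s r V).mulVec v = 0 := by
    have := congrArg (((legendreMatrix s).transpose *
      Matrix.diagonal (gaussWeight s)).mulVec) h1
    rwa [Matrix.mulVec_mulVec, legendreMatrix_transpose_mul, Matrix.one_mulVec,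
      Matrix.mulVec_zero] at this
  have h3 := congrFun h2 ⟨η + i, by omega⟩
  -- Columns before η of the corner matrix are zero, and x^η has no coefficients beyond η, so only
  -- column η survives. Its coefficient is not zero.
  rw [Matrix.mulVec, dotProduct, Finset.sum_eq_single (⟨η, by omega⟩ : Fin s)] at h3
  · rw [Pi.zero_apply] at h3
    have h4 := (mul_eq_zero.1 h3).resolve_right (polyIntegral_legendrePoly_mul_X_pow_self_ne_zero η)
    simp only [cornerMatrix, Matrix.of_apply, ← hη] at h4
    rw [if_pos ⟨by omega, le_rfl⟩] at h4
    convert h4 using 2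
    · ext; simp
    · ext; simp
  · intro l _ hl
    by_cases hle : η < (l : ℕ)
    · rw [hv]
      simp only
      rw [polyIntegral_legendrePoly_mul_X_pow hle, mul_zero]
    · rw [cornerMatrix, Matrix.of_apply, if_neg, zero_mul]
      rintro ⟨-, h5⟩
      exact hl (Fin.ext (by simp; omega))
  · simp

end Perturbed

/-! ### Local solvability of the stage equations -/

namespace ButcherTableau

section Implicit

variable {s : ℕ} {E : Type*} [NormedAddCommGroup E] [NormedSpace ℝ E]

/-- The residual of the stage equations at `((h, y₀), Y)`. -/
def stageResidual (M : ButcherTableau s) (f : ℝ → E → E) (t₀ : ℝ) (p : (ℝ × E) × (Fin s → E)) :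
    Fin s → E :=
  fun i => p.2 i - p.1.2 - p.1.1 • ∑ j, M.A i j • Function.uncurry f (t₀ + M.c j * p.1.1, p.2 j)

theorem stageResidual_eq_zero_iff (M : ButcherTableau s) (f : ℝ → E → E) (t₀ : ℝ)
    (p : (ℝ × E) × (Fin s → E)) :
    M.stageResidual f t₀ p = 0 ↔ M.IsStages f t₀ p.1.1 p.1.2 p.2 := by
  simp only [funext_iff, stageResidual, IsStages, Pi.zero_apply, Function.uncurry]
  refine forall_congr' fun i => ?_
  rw [sub_sub, sub_eq_zero]

theorem contDiffAt_stageResidual (M : ButcherTableau s) {f : ℝ → E → E} {t₀ : ℝ} {y₀ : E}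
    (hf : ContDiffAt ℝ 1 (Function.uncurry f) (t₀, y₀)) :
    ContDiffAt ℝ 1 (M.stageResidual f t₀) ((0, y₀), fun _ => y₀) := by
  rw [contDiffAt_pi]
  intro i
  have hfj : ∀ j, ContDiffAt ℝ 1 (fun p : (ℝ × E) × (Fin s → E) =>
      Function.uncurry f (t₀ + M.c j * p.1.1, p.2 j)) ((0, y₀), fun _ => y₀) := by
    intro j
    refine ContDiffAt.comp (g := Function.uncurry f)
      (f := fun p : (ℝ × E) × (Fin s → E) => (t₀ + M.c j * p.1.1, p.2 j)) _ ?_ ?_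
    · simpa using hf
    · fun_prop
  unfold stageResidual
  refine ContDiffAt.sub (by fun_prop) (ContDiffAt.smul (by fun_prop) ?_)
  exact ContDiffAt.sum fun j _ => (hfj j).const_smul _

/-- Near `(0, y₀)`, the stage equations define the internal stages as a `C¹` function of the
stepsize and the starting point. -/
theorem exists_stages [CompleteSpace E] (M : ButcherTableau s) {f : ℝ → E → E} {t₀ : ℝ} {y₀ : E}
    (hf : ContDiffAt ℝ 1 (Function.uncurry f) (t₀, y₀)) :
    ∃ φ : ℝ × E → Fin s → E, ContDiffAt ℝ 1 φ (0, y₀) ∧ φ (0, y₀) = (fun _ => y₀) ∧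
      (∀ᶠ p in 𝓝 (0, y₀), M.IsStages f t₀ p.1 p.2 (φ p)) ∧
      ∀ᶠ p in 𝓝 (((0 : ℝ), y₀), fun _ : Fin s => y₀),
        M.IsStages f t₀ p.1.1 p.1.2 p.2 → φ p.1 = p.2 := by
  have hG := M.contDiffAt_stageResidual hf
  have h0 : M.stageResidual f t₀ ((0, y₀), fun _ => y₀) = 0 := by
    ext i; simp [stageResidual]
  -- At h = 0 the residual is Y - y₀, so its partial derivative in Y is the identity.
  have hinv : (fderiv ℝ (M.stageResidual f t₀) ((0, y₀), fun _ => y₀) ∘L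
      .inr ℝ (ℝ × E) (Fin s → E)).IsInvertible := by
    have h1 := (hG.differentiableAt one_ne_zero).hasFDerivAt.comp (fun _ : Fin s => y₀)
      (hasFDerivAt_prodMk_right ((0 : ℝ), y₀) (fun _ : Fin s => y₀))
    have h2 : HasFDerivAt (M.stageResidual f t₀ ∘ fun Y => ((0, y₀), Y))
        (ContinuousLinearMap.id ℝ (Fin s → E)) (fun _ => y₀) := by
      have h3 : (M.stageResidual f t₀ ∘ fun Y => ((0, y₀), Y)) =
          fun Y : Fin s → E => Y - fun _ => y₀ := by
        ext Y i; simp [stageResidual]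
      rw [h3]
      exact (hasFDerivAt_id _).sub_const _
    rw [h1.unique h2]
    exact ⟨ContinuousLinearEquiv.refl ℝ _, rfl⟩
  refine ⟨hG.implicitFunction one_ne_zero hinv, hG.contDiffAt_implicitFunction one_ne_zero hinv,
    hG.implicitFunction_apply_self one_ne_zero hinv, ?_, ?_⟩
  · filter_upwards [hG.eventually_apply_implicitFunction one_ne_zero hinv] with p hp
    rw [h0] at hp
    exact (M.stageResidual_eq_zero_iff f t₀ _).1 hp
  · filter_upwards [hG.eventually_apply_eq_iff_implicitFunction one_ne_zero hinv] with p hp hst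
    rw [h0] at hp
    exact hp.1 ((M.stageResidual_eq_zero_iff f t₀ _).2 hst)

end Implicit

/-! ### Symplecticity -/

/-- The form is infinitesimally invariant at every stage (`hkl`). Weighting these relations by bᵢ
rewrites the terms linear in h as -h² ∑ bᵢbⱼB(kᵢ,lⱼ), by the symplectic identity, and this cancels
the quadratic term of the step. -/
theorem SatisfiesSymplecticIdentity.bilin_step_eq {s : ℕ} {M : ButcherTableau s}
    (hM : M.SatisfiesSymplecticIdentity) {E : Type*} [AddCommGroup E] [Module ℝ E]
    (B : E →ₗ[ℝ] E →ₗ[ℝ] ℝ) (h : ℝ) (u v : E) (k l : Fin s → E)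
    (hkl : ∀ i, B (u + h • ∑ j, M.A i j • k j) (l i) + B (k i) (v + h • ∑ j, M.A i j • l j) = 0) :
    B (u + h • ∑ j, M.b j • k j) (v + h • ∑ j, M.b j • l j) = B u v := by
  simp only [map_add, map_smul, map_sum, LinearMap.add_apply, LinearMap.smul_apply,
    LinearMap.sum_apply, smul_eq_mul] at hkl ⊢
  have h1 : ∑ i, M.b i * (B u (l i) + B (k i) v) =
      -(h * ∑ i, ∑ j, M.b i * M.b j * B (k i) (l j)) := by
    have h2 : ∀ i, M.b i * (B u (l i) + B (k i) v) =
        -(h * (∑ j, M.b i * M.A i j * B (k j) (l i) + ∑ j, M.b i * M.A i j * B (k i) (l j))) := by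
      intro i
      have h3 := hkl i
      have h4 : ∀ g : Fin s → ℝ, ∑ j, M.b i * M.A i j * g j = M.b i * ∑ j, M.A i j * g j := by
        intro g; rw [Finset.mul_sum]; exact Finset.sum_congr rfl fun j _ => by ring
      rw [h4, h4]
      linear_combination M.b i * h3
    rw [Finset.sum_congr rfl fun i _ => h2 i, Finset.sum_neg_distrib, ← Finset.mul_sum,
      Finset.sum_add_distrib,
      Finset.sum_comm (f := fun i j => M.b i * M.A i j * B (k j) (l i)), ← Finset.sum_add_distrib]
    congr 2
    refine Finset.sum_congr rfl fun i _ => ?_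
    rw [← Finset.sum_add_distrib]
    refine Finset.sum_congr rfl fun j _ => ?_
    rw [← hM i j]; ring
  have h5 : ∑ i, M.b i * (B u (l i) + B (k i) v) =
      ∑ i, M.b i * B u (l i) + ∑ i, M.b i * B (k i) v := by
    rw [← Finset.sum_add_distrib]; exact Finset.sum_congr rfl fun i _ => by ring
  have h6 : ∑ j, M.b j * ∑ i, M.b i * B (k i) (l j) =
      ∑ i, ∑ j, M.b i * M.b j * B (k i) (l j) := by
    rw [Finset.sum_comm]
    refine Finset.sum_congr rfl fun j _ => ?_
    rw [Finset.mul_sum]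
    exact Finset.sum_congr rfl fun i _ => by ring
  have h7 : ∀ x : Fin s, M.b x * (h * ∑ i, M.b i * B (k i) (l x)) =
    h * (M.b x * ∑ i, M.b i * B (k i) (l x)) := fun x => by ring
  rw [h5] at h1
  simp only [mul_add, Finset.sum_add_distrib, h7, ← Finset.mul_sum, h6]
  linear_combination h * h1

end ButcherTableau

/-! ### The symplectic form and linearized Hamiltonian fields. -/

theorem structureMatrix_mul_self (m : ℕ) : structureMatrix m * structureMatrix m = -1 := by
  rw [structureMatrix, Matrix.fromBlocks_multiply, ← Matrix.fromBlocks_one, Matrix.fromBlocks_neg]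
  simp

theorem structureMatrix_transpose (m : ℕ) :
    (structureMatrix m).transpose = -structureMatrix m := by
  rw [structureMatrix, Matrix.fromBlocks_transpose, Matrix.fromBlocks_neg]
  simp

section Hamiltonian

variable {m : ℕ} {H : PhaseSpace m → ℝ} {U : Set (PhaseSpace m)}

open Matrix in
theorem contDiffAt_hamiltonianField {y : PhaseSpace m} (hH : ContDiffAt ℝ 2 H y) :
    ContDiffAt ℝ 1 (hamiltonianField H) y := by
  have h1 : ContDiffAt ℝ 1 (fderiv ℝ H) y := hH.fderiv_right (by norm_num)
  have h2 : hamiltonianField H = fun z =>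
      LinearMap.toContinuousLinearMap (Matrix.toLin' (structureMatrix m))
        (fun i => fderiv ℝ H z (Pi.single i 1)) := rfl
  rw [h2]
  refine (ContinuousLinearMap.contDiff _).contDiffAt.comp y ?_
  rw [contDiffAt_pi]
  intro i
  exact h1.clm_apply contDiffAt_const

open Matrix in
theorem fderiv_hamiltonianField_apply {y : PhaseSpace m} (hH : ContDiffAt ℝ 2 H y)
    (v : PhaseSpace m) :
    fderiv ℝ (hamiltonianField H) y v =
      structureMatrix m *ᵥ fun i => fderiv ℝ (fderiv ℝ H) y v (Pi.single i 1) := by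
  have h1 : ContDiffAt ℝ 1 (fderiv ℝ H) y := hH.fderiv_right (by norm_num)
  have h2 : HasFDerivAt (fun z => (fun i => fderiv ℝ H z (Pi.single i 1) : PhaseSpace m))
      (ContinuousLinearMap.pi fun i =>
        (ContinuousLinearMap.apply ℝ ℝ (Pi.single i 1 : PhaseSpace m)) ∘L
          fderiv ℝ (fderiv ℝ H) y) y := by
    rw [hasFDerivAt_pi]
    intro i
    exact (ContinuousLinearMap.hasFDerivAt
      (ContinuousLinearMap.apply ℝ ℝ (Pi.single i 1 : PhaseSpace m))).comp y
      (h1.differentiableAt one_ne_zero).hasFDerivAt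
  have h3 := ((LinearMap.toContinuousLinearMap
    (Matrix.toLin' (structureMatrix m))).hasFDerivAt).comp y h2
  have h4 : HasFDerivAt (hamiltonianField H) _ y := h3
  rw [h4.fderiv]
  rfl

open Matrix in
/-- The standard symplectic form `(u, v) ↦ uᵀ J v`. -/
def symplecticForm (m : ℕ) : PhaseSpace m →ₗ[ℝ] PhaseSpace m →ₗ[ℝ] ℝ :=
  Matrix.toLinearMap₂' ℝ (structureMatrix m)

open Matrix in
theorem symplecticForm_apply (u v : PhaseSpace m) :
    symplecticForm m u v = u ⬝ᵥ (structureMatrix m *ᵥ v) :=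
  Matrix.toLinearMap₂'_apply' _ _ _

open Matrix in
theorem dotProduct_apply_single (L : PhaseSpace m →L[ℝ] ℝ) (a : PhaseSpace m) :
    a ⬝ᵥ (fun i => L (Pi.single i 1)) = L a := by
  conv_rhs => rw [pi_eq_sum_univ' a]
  rw [map_sum, dotProduct]
  refine Finset.sum_congr rfl fun i _ => ?_
  rw [map_smul, smul_eq_mul]

open Matrix in
/-- The linearized Hamiltonian field is infinitesimally symplectic. -/
theorem symplecticForm_fderiv_hamiltonianField {y : PhaseSpace m} (hH : ContDiffAt ℝ 2 H y)
    (a b : PhaseSpace m) :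
    symplecticForm m a (fderiv ℝ (hamiltonianField H) y b) +
      symplecticForm m (fderiv ℝ (hamiltonianField H) y a) b = 0 := by
  -- With Hessian S, the two terms are -aᵀSb and bᵀSa, which cancel by symmetry of S.
  have hsymm : IsSymmSndFDerivAt ℝ H y := hH.isSymmSndFDerivAt (by simp)
  have h1 : ∀ p q : PhaseSpace m,
      (structureMatrix m *ᵥ p) ⬝ᵥ (structureMatrix m *ᵥ q) = q ⬝ᵥ p := by
    intro p q
    rw [dotProduct_mulVec, vecMul_mulVec, structureMatrix_transpose, neg_mul,
      structureMatrix_mul_self, neg_neg, vecMul_one, dotProduct_comm]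
  rw [symplecticForm_apply, symplecticForm_apply, fderiv_hamiltonianField_apply hH,
    fderiv_hamiltonianField_apply hH, h1, mulVec_mulVec, structureMatrix_mul_self, neg_mulVec,
    one_mulVec, dotProduct_neg, dotProduct_apply_single, dotProduct_apply_single, hsymm a b]
  ring

end Hamiltonian

namespace ButcherTableau

variable {s m : ℕ} {H : PhaseSpace m → ℝ} {U : Set (PhaseSpace m)}

theorem exists_isStageBranch (M : ButcherTableau s) (hU : IsOpen U) (hH : ContDiffOn ℝ 2 H U)
    {y₀ : PhaseSpace m} (hy₀ : y₀ ∈ U) {δ : ℝ} (hδ : 0 < δ) :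
    ∃ h₀ > 0, ∃ D : Set (PhaseSpace m), y₀ ∈ D ∧ ∀ h : ℝ, |h| ≤ h₀ →
      ∃ Y : PhaseSpace m → Fin s → PhaseSpace m, M.IsStageBranch H U h D Y ∧
        ∀ y ∈ D, ∀ i, Y y i ∈ Metric.ball y₀ δ := by
  have hX := contDiffAt_hamiltonianField ((hH y₀ hy₀).contDiffAt (hU.mem_nhds hy₀))
  have hf : ContDiffAt ℝ 1 (Function.uncurry fun _ : ℝ => hamiltonianField H) (0, y₀) :=
    ContDiffAt.comp (g := hamiltonianField H) (f := Prod.snd) _ hX contDiffAt_snd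
  obtain ⟨φ, hφ, hφ0, hst, -⟩ := M.exists_stages hf
  have hd : ∀ᶠ p in 𝓝 ((0 : ℝ), y₀), DifferentiableAt ℝ φ p :=
    (hφ.eventually (by simp)).mono fun p hp => hp.differentiableAt one_ne_zero
  have hmem : ∀ᶠ p in 𝓝 ((0 : ℝ), y₀), ∀ i, φ p i ∈ U ∩ Metric.ball y₀ δ := by
    rw [Filter.eventually_all]
    intro i
    have hc : ContinuousAt (fun p => φ p i) ((0 : ℝ), y₀) :=
      (continuous_apply i).continuousAt.comp hφ.continuousAt
    apply hc
    simp only [hφ0]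
    exact Filter.inter_mem (hU.mem_nhds hy₀) (Metric.ball_mem_nhds _ hδ)
  obtain ⟨ε, hε, hball⟩ := Metric.eventually_nhds_iff_ball.1 (hst.and (hd.and hmem))
  refine ⟨ε / 2, by positivity, Metric.ball y₀ ε, Metric.mem_ball_self hε, fun h hh =>
    ⟨fun y => φ (h, y), ⟨Metric.isOpen_ball, ?_, ?_⟩, ?_⟩⟩
  all_goals
    have hin : ∀ y ∈ Metric.ball y₀ ε, (h, y) ∈ Metric.ball ((0 : ℝ), y₀) ε := by
      intro y hy
      rw [← ball_prod_same]
      refine ⟨?_, hy⟩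
      rw [mem_ball_zero_iff, Real.norm_eq_abs]
      linarith
  · intro y hy
    have h1 := (hball _ (hin y hy)).2.1
    exact (h1.comp y (by fun_prop : DifferentiableAt ℝ (fun y => (h, y)) y)).differentiableWithinAt
  · intro y hy
    exact ⟨fun i => ((hball _ (hin y hy)).2.2 i).1, (hball _ (hin y hy)).1⟩
  · intro y hy i
    exact ((hball _ (hin y hy)).2.2 i).2

-- Differentiating the stage equations along the branch shows that tangent vectors undergo a linear
-- Runge–Kutta step with slopes `K`, to which `bilin_step_eq` applies. Differentiability of the
-- branch is given, so h need not be small.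
open Matrix in
theorem SatisfiesSymplecticIdentity.isSymplecticMapOn {M : ButcherTableau s}
    (hM : M.SatisfiesSymplecticIdentity) (hU : IsOpen U) (hH : ContDiffOn ℝ 2 H U) {h : ℝ}
    {D : Set (PhaseSpace m)} {Y : PhaseSpace m → Fin s → PhaseSpace m}
    (hY : M.IsStageBranch H U h D Y) :
    IsSymplecticMapOn (fun y => M.step (fun _ => hamiltonianField H) 0 h y (Y y)) D := by
  obtain ⟨hD, hdiff, hst⟩ := hY
  have hH2 : ∀ y ∈ D, ∀ i, ContDiffAt ℝ 2 H (Y y i) := fun y hy i =>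
    (hH _ ((hst y hy).1 i)).contDiffAt (hU.mem_nhds ((hst y hy).1 i))
  have hYi : ∀ y ∈ D, ∀ i, HasFDerivAt (fun z => Y z i)
      (ContinuousLinearMap.proj i ∘L fderiv ℝ Y y) y := by
    intro y hy i
    exact (ContinuousLinearMap.hasFDerivAt (ContinuousLinearMap.proj i)).comp y
      (hdiff.differentiableAt (hD.mem_nhds hy)).hasFDerivAt
  set K : PhaseSpace m → Fin s → PhaseSpace m →L[ℝ] PhaseSpace m := fun y j =>
    fderiv ℝ (hamiltonianField H) (Y y j) ∘L (ContinuousLinearMap.proj j ∘L fderiv ℝ Y y) with hK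
  have hFY : ∀ y ∈ D, ∀ j, HasFDerivAt (fun z => hamiltonianField H (Y z j)) (K y j) y := by
    intro y hy j
    exact HasFDerivAt.comp (g := hamiltonianField H) (f := fun z => Y z j) y
      ((contDiffAt_hamiltonianField (hH2 y hy j)).differentiableAt one_ne_zero).hasFDerivAt
      (hYi y hy j)
  have hcomb : ∀ y ∈ D, ∀ w : Fin s → ℝ,
      HasFDerivAt (fun z => z + h • ∑ j, w j • hamiltonianField H (Y z j))
        (ContinuousLinearMap.id ℝ _ + h • ∑ j, w j • K y j) y := by
    intro y hy w
    exact (hasFDerivAt_id y).add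
      ((HasFDerivAt.fun_sum fun j _ => (hFY y hy j).const_smul (w j)).const_smul h)
  have hΦ : ∀ y ∈ D, HasFDerivAt (fun y => M.step (fun _ => hamiltonianField H) 0 h y (Y y))
      (ContinuousLinearMap.id ℝ _ + h • ∑ j, M.b j • K y j) y := fun y hy => hcomb y hy M.b
  refine ⟨fun y hy => (hΦ y hy).differentiableAt.differentiableWithinAt, fun y hy => ?_⟩
  have hL : ∀ i v, fderiv ℝ Y y v i = v + h • ∑ j, M.A i j • K y j v := by
    intro i v
    have h1 : (fun z => Y z i) =ᶠ[𝓝 y]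
        fun z => z + h • ∑ j, M.A i j • hamiltonianField H (Y z j) := by
      filter_upwards [hD.mem_nhds hy] with z hz using (hst z hz).2 i
    have h2 := (hYi y hy i).unique ((hcomb y hy (M.A i)).congr_of_eventuallyEq h1)
    have h3 := congrArg (fun T : PhaseSpace m →L[ℝ] PhaseSpace m => T v) h2
    simpa [_root_.sum_apply] using h3
  have hω : ∀ u v, symplecticForm m
      (fderiv ℝ (fun y => M.step (fun _ => hamiltonianField H) 0 h y (Y y)) y u)
      (fderiv ℝ (fun y => M.step (fun _ => hamiltonianField H) 0 h y (Y y)) y v) =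
      symplecticForm m u v := by
    intro u v
    rw [(hΦ y hy).fderiv]
    have := hM.bilin_step_eq (symplecticForm m) h u v (fun j => K y j u) (fun j => K y j v) ?_
    · simpa [_root_.sum_apply] using this
    · intro i
      rw [← hL, ← hL]
      exact symplecticForm_fderiv_hamiltonianField (hH2 y hy i) _ _
  ext i j
  have h1 := hω (Pi.single i 1) (Pi.single j 1)
  rw [symplecticForm_apply, symplecticForm_apply] at h1
  have h2 : ∀ (S : Matrix (Fin m ⊕ Fin m) (Fin m ⊕ Fin m) ℝ) (k : Fin m ⊕ Fin m),
      S *ᵥ Pi.single k 1 = S.col k := fun S k => mulVec_single_one S k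
  rw [h2, single_one_dotProduct] at h1
  refine Eq.trans ?_ h1
  rw [Matrix.mul_assoc, Matrix.mul_apply, dotProduct]
  refine Finset.sum_congr rfl fun k _ => ?_
  rfl

/-- A Runge–Kutta method satisfying `bᵢ aᵢⱼ + bⱼ aⱼᵢ = bᵢ bⱼ` is symplectic. -/
theorem SatisfiesSymplecticIdentity.isSymplectic {M : ButcherTableau s}
    (hM : M.SatisfiesSymplecticIdentity) : M.IsSymplectic := fun _ _ _ hU hH =>
  ⟨fun _ hy₀ _ hδ => M.exists_isStageBranch hU hH hy₀ hδ,
    fun _ _ _ hY => hM.isSymplecticMapOn hU hH hY⟩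

end ButcherTableau

/-! ### Asymptotics at a vanishing stepsize -/

section Asymptotic

open Asymptotics Filter

variable {E F : Type*} [NormedAddCommGroup E] [NormedAddCommGroup F]

/-- `f h = O(h ^ n)` as `h → 0`. -/
def VanishesToOrder (f : ℝ → E) (n : ℕ) : Prop := f =O[𝓝 (0 : ℝ)] fun h => h ^ n

namespace VanishesToOrder

variable {f g : ℝ → E} {n k : ℕ}

theorem mono (hf : VanishesToOrder f n) (hk : k ≤ n) : VanishesToOrder f k := by
  refine IsBigO.trans hf ?_
  obtain ⟨l, rfl⟩ := Nat.exists_eq_add_of_le hk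
  have h1 : (fun h : ℝ => h ^ l) =O[𝓝 (0 : ℝ)] (fun _ => (1 : ℝ)) :=
    ((continuous_pow l).tendsto 0).isBigO_one ℝ
  simpa [pow_add] using (isBigO_refl (fun h : ℝ => h ^ k) (𝓝 0)).mul h1

theorem add (hf : VanishesToOrder f n) (hg : VanishesToOrder g n) :
    VanishesToOrder (fun h => f h + g h) n := IsBigO.add hf hg

theorem sub (hf : VanishesToOrder f n) (hg : VanishesToOrder g n) :
    VanishesToOrder (fun h => f h - g h) n := IsBigO.sub hf hg

theorem sum {ι : Type*} {t : Finset ι} {f : ι → ℝ → E} (hf : ∀ i ∈ t, VanishesToOrder (f i) n) :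
    VanishesToOrder (fun h => ∑ i ∈ t, f i h) n := IsBigO.fun_sum hf

theorem congr (hf : VanishesToOrder f n) (h : ∀ᶠ x in 𝓝 (0 : ℝ), f x = g x) :
    VanishesToOrder g n := IsBigO.congr' hf h EventuallyEq.rfl

theorem comp_mul_left (hf : VanishesToOrder f n) (c : ℝ) :
    VanishesToOrder (fun h => f (c * h)) n := by
  have ht : Tendsto (fun h : ℝ => c * h) (𝓝 0) (𝓝 0) := by
    have := (continuous_const_mul c).tendsto (0 : ℝ)
    simpa using this
  have h1 := IsBigO.comp_tendsto hf ht
  refine h1.trans ?_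
  simp only [Function.comp_def, mul_pow]
  exact isBigO_const_mul_self _ _ _

end VanishesToOrder

variable [NormedSpace ℝ E] [NormedSpace ℝ F]

namespace VanishesToOrder

variable {f : ℝ → E} {n k : ℕ}

theorem const_smul (c : ℝ) (hf : VanishesToOrder f n) : VanishesToOrder (fun h => c • f h) n :=
  hf.const_smul_left c

theorem pow_smul (hf : VanishesToOrder f n) (k : ℕ) :
    VanishesToOrder (fun h => h ^ k • f h) (k + n) := by
  have := (isBigO_refl (fun h : ℝ => h ^ k) (𝓝 0)).smul hf
  simpa only [VanishesToOrder, pow_add, smul_eq_mul] using this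

theorem smul_id (hf : VanishesToOrder f n) : VanishesToOrder (fun h => h • f h) (n + 1) := by
  simpa [add_comm] using hf.pow_smul 1

theorem clm_apply {L : ℝ → E →L[ℝ] F} (hL : VanishesToOrder L k) (hf : VanishesToOrder f n) :
    VanishesToOrder (fun h => L h (f h)) (k + n) := by
  have h1 : (fun h => L h (f h)) =O[𝓝 (0 : ℝ)] fun h => ‖L h‖ * ‖f h‖ :=
    IsBigO.of_bound 1 (Eventually.of_forall fun h => by
      rw [one_mul, Real.norm_of_nonneg (by positivity)]; exact (L h).le_opNorm _)
  refine h1.trans ?_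
  simpa only [pow_add] using IsBigO.mul hL.norm_left hf.norm_left

theorem const_clm (L : E →L[ℝ] F) (hf : VanishesToOrder f n) :
    VanishesToOrder (fun h => L (f h)) n :=
  (L.isBigO_comp f (𝓝 0)).trans hf

end VanishesToOrder

theorem vanishesToOrder_of_hasDerivAt {g g' : ℝ → E} {n : ℕ}
    (hg : ∀ᶠ x in 𝓝 (0 : ℝ), HasDerivAt g (g' x) x) (h0 : g 0 = 0)
    (hg' : VanishesToOrder g' n) : VanishesToOrder g (n + 1) := by
  obtain ⟨C, hC⟩ := IsBigO.bound hg'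
  obtain ⟨ε, hε, hball⟩ := Metric.eventually_nhds_iff_ball.1 (hg.and hC)
  refine IsBigO.of_bound |C| ?_
  filter_upwards [Metric.ball_mem_nhds (0 : ℝ) hε] with x hx
  have hsub : ∀ y ∈ segment ℝ 0 x, y ∈ Metric.ball (0 : ℝ) ε := fun y hy =>
    (convex_ball (0 : ℝ) ε).segment_subset (Metric.mem_ball_self hε) hx hy
  have hle : ∀ y ∈ segment ℝ 0 x, |y| ≤ |x| := by
    intro y hy
    rw [segment_eq_uIcc] at hy
    have := Set.abs_sub_left_of_mem_uIcc hy
    simpa using this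
  have hC0 : ∀ y ∈ segment ℝ 0 x, ‖g' y‖ ≤ |C| * |x| ^ n := by
    intro y hy
    refine (hball y (hsub y hy)).2.trans ?_
    rw [norm_pow, Real.norm_eq_abs]
    have := hle y hy
    have := le_abs_self C
    gcongr
  have key := (convex_segment (0 : ℝ) x).norm_image_sub_le_of_norm_hasDerivWithin_le
    (fun y hy => (hball y (hsub y hy)).1.hasDerivWithinAt) hC0 (left_mem_segment ℝ 0 x)
    (right_mem_segment ℝ 0 x)
  rw [h0, sub_zero, sub_zero, mul_assoc, Real.norm_eq_abs x, ← pow_succ] at key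
  rwa [norm_pow, Real.norm_eq_abs x]

/-- Integration of an expansion in powers of `x`. -/
theorem vanishesToOrder_integrate {y y' : ℝ → E} {t₀ : ℝ} {n : ℕ} {a : ℕ → E}
    (hy : ∀ᶠ t in 𝓝 t₀, HasDerivAt y (y' t) t)
    (ha : VanishesToOrder (fun x => y' (t₀ + x) - ∑ k ∈ Finset.range n, x ^ k • a k) n) :
    VanishesToOrder (fun x => y (t₀ + x) - y t₀ -
      ∑ k ∈ Finset.range n, (x ^ (k + 1) / ((k : ℝ) + 1)) • a k) (n + 1) := by
  refine vanishesToOrder_of_hasDerivAt ?_ (by simp) ha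
  have ht : Tendsto (fun x : ℝ => t₀ + x) (𝓝 0) (𝓝 t₀) := by
    simpa using (continuous_const_add t₀).tendsto (0 : ℝ)
  filter_upwards [ht.eventually hy] with x hx
  refine ((hx.comp_const_add t₀ x).sub_const _).sub (HasDerivAt.fun_sum fun k _ => ?_)
  have h1 := ((hasDerivAt_pow (k + 1) x).div_const ((k : ℝ) + 1)).smul_const (a k)
  convert h1 using 2
  have : (k : ℝ) + 1 ≠ 0 := by positivity
  push_cast
  field_simp

/-- Taylor's theorem with an unspecified remainder. -/
theorem exists_taylor_expansion {g : ℝ → E} {t₀ : ℝ} {n : ℕ} (hg : ContDiffAt ℝ n g t₀) :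
    ∃ a : ℕ → E,
      VanishesToOrder (fun x => g (t₀ + x) - ∑ k ∈ Finset.range n, x ^ k • a k) n := by
  induction n generalizing g with
  | zero =>
    refine ⟨fun _ => 0, ?_⟩
    have hc : ContinuousAt (fun x => g (t₀ + x)) 0 := by
      refine ContinuousAt.comp (g := g) ?_ (by fun_prop)
      simpa using hg.continuousAt
    simpa [VanishesToOrder] using hc.tendsto.isBigO_one ℝ
  | succ n ih =>
    have hg' : ContDiffAt ℝ n (deriv g) t₀ := by
      have h1 : ContDiffAt ℝ n (fderiv ℝ g) t₀ := hg.fderiv_right (by simp)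
      exact h1.clm_apply contDiffAt_const
    obtain ⟨a, ha⟩ := ih hg'
    have hd : ∀ᶠ t in 𝓝 t₀, HasDerivAt g (deriv g t) t :=
      (hg.eventually (by simp)).mono fun t ht => (ht.differentiableAt (by simp)).hasDerivAt
    refine ⟨fun k => if k = 0 then g t₀ else ((1 : ℝ) / (k : ℝ)) • a (k - 1), ?_⟩
    refine (vanishesToOrder_integrate hd ha).congr (Eventually.of_forall fun x => ?_)
    rw [Finset.sum_range_succ']
    simp only [pow_zero, one_smul, if_true, Nat.succ_ne_zero, if_false, Nat.add_sub_cancel,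
      smul_smul, mul_one_div, Nat.cast_add, Nat.cast_one]
    abel

/-- The linearization error of a `C²` map is quadratic, uniformly near a point. -/
theorem exists_norm_sub_sub_fderiv_le {g : E → F} {x₀ : E} (hg : ContDiffAt ℝ 2 g x₀) :
    ∃ C : ℝ, ∀ᶠ p in 𝓝 (x₀, x₀),
      ‖g p.2 - g p.1 - fderiv ℝ g p.1 (p.2 - p.1)‖ ≤ C * (‖p.2 - p.1‖ * ‖p.2 - p.1‖) := by
  have h1 : ContDiffAt ℝ 1 (fderiv ℝ g) x₀ := hg.fderiv_right (by norm_num)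
  -- A local Lipschitz constant of the derivative serves as `C`, by the mean value inequality on the
  -- segment.
  obtain ⟨K, t, ht, hK⟩ := h1.exists_lipschitzOnWith
  have hd : ∀ᶠ x in 𝓝 x₀, DifferentiableAt ℝ g x :=
    (hg.eventually (by simp)).mono fun x hx => hx.differentiableAt (by simp)
  obtain ⟨ε, hε, hball⟩ := Metric.eventually_nhds_iff_ball.1 (hd.and ht)
  refine ⟨K, ?_⟩
  filter_upwards [Metric.ball_mem_nhds (x₀, x₀) hε] with p hp
  rw [← ball_prod_same] at hp
  have hsub : segment ℝ p.1 p.2 ⊆ Metric.ball x₀ ε := (convex_ball x₀ ε).segment_subset hp.1 hp.2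
  rw [← mul_assoc]
  refine (convex_segment p.1 p.2).norm_image_sub_le_of_norm_fderiv_le'
    (fun x hx => (hball x (hsub hx)).1) (fun x hx => ?_) (left_mem_segment ℝ _ _)
    (right_mem_segment ℝ _ _)
  refine (hK.norm_sub_le (hball x (hsub hx)).2 (hball _ hp.1).2).trans ?_
  gcongr
  obtain ⟨a, b, ha, hb, hab, rfl⟩ := hx
  have : a • p.1 + b • p.2 - p.1 = b • (p.2 - p.1) := by
    rw [← eq_sub_iff_add_eq] at hab
    rw [hab]; module
  rw [this, norm_smul, Real.norm_of_nonneg hb]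
  have : b ≤ 1 := by linarith
  nlinarith [norm_nonneg (p.2 - p.1)]

/-- A solution of `y' = f t y` is as smooth as `f` allows. -/
theorem contDiffAt_solution {f : ℝ → E → E} {t₀ : ℝ} {y : ℝ → E} {k : ℕ}
    (hf : ContDiffAt ℝ k (Function.uncurry f) (t₀, y t₀))
    (hy : ∀ᶠ t in 𝓝 t₀, HasDerivAt y (f t (y t)) t) :
    ContDiffAt ℝ k y t₀ := by
  have hcomp : ∀ n : ℕ, n ≤ k → ContDiffAt ℝ n y t₀ →
      ContDiffAt ℝ n (fun t => f t (y t)) t₀ := fun n hn h =>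
    ContDiffAt.comp (g := Function.uncurry f) (f := fun t => (t, y t)) t₀
      (hf.of_le (by exact_mod_cast hn)) (contDiffAt_id.prodMk h)
  suffices H : ∀ n : ℕ, n ≤ k → ContDiffAt ℝ n y t₀ from H k le_rfl
  intro n
  induction n with
  | zero =>
    intro _
    refine contDiffAt_zero.2 ⟨_, hy, fun t ht => ?_⟩
    exact (HasDerivAt.continuousAt ht).continuousWithinAt
  | succ n ih =>
    intro hn
    refine contDiffAt_succ_iff_hasFDerivAt.2
      ⟨fun t => ContinuousLinearMap.toSpanSingleton ℝ (f t (y t)), ⟨_, hy, fun t ht => ?_⟩, ?_⟩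
    · exact HasDerivAt.hasFDerivAt ht
    · exact (ContinuousLinearMap.toSpanSingletonCLE (𝕜 := ℝ) (E := E)).contDiff.contDiffAt.comp t₀
        (hcomp n (by omega) (ih (by omega)))

end Asymptotic

/-! ### Order of methods satisfying the simplifying assumptions -/

namespace ButcherTableau

open Asymptotics Filter

variable {s η : ℕ} {M : ButcherTableau s}

/-- The simplifying assumption `D(η)` follows from `C(η)` and the symplectic identity. -/
theorem SatisfiesSymplecticIdentity.sum_weight_mul_A (hM : M.SatisfiesSymplecticIdentity)
    (hC : M.StageOrder η) {m : ℕ} (hm : m < η) (hB : ∑ i, M.b i * M.c i ^ m = 1 / ((m : ℝ) + 1))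
    (j : Fin s) :
    ∑ i, M.b i * M.c i ^ m * M.A i j = (M.b j - M.b j * M.c j ^ (m + 1)) / ((m : ℝ) + 1) := by
  have h1 : ∑ i, M.b i * M.c i ^ m * M.A i j =
      M.b j * ∑ i, M.b i * M.c i ^ m - M.b j * ∑ i, M.A j i * M.c i ^ m := by
    rw [Finset.mul_sum, Finset.mul_sum, ← Finset.sum_sub_distrib]
    refine Finset.sum_congr rfl fun i _ => ?_
    linear_combination M.c i ^ m * hM i j
  rw [h1, hB, hC m hm j]
  ring

/-- The symmetric part of the matrix (bᵢaᵢⱼ) is half of bbᵀ, so its quadratic form depends on the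
weights alone. -/
theorem SatisfiesSymplecticIdentity.sum_sum_mul_A_mul (hM : M.SatisfiesSymplecticIdentity)
    (x : Fin s → ℝ) :
    2 * ∑ j, (∑ i, M.b i * x i * M.A i j) * x j = (∑ i, M.b i * x i) * ∑ i, M.b i * x i := by
  have h1 : ∑ j, (∑ i, M.b i * x i * M.A i j) * x j =
      ∑ i, ∑ j, M.b i * x i * M.A i j * x j := by
    rw [Finset.sum_comm]
    exact Finset.sum_congr rfl fun j _ => Finset.sum_mul _ _ _
  have h2 : ∑ j, (∑ i, M.b i * x i * M.A i j) * x j =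
      ∑ i, ∑ j, M.b j * x j * M.A j i * x i :=
    Finset.sum_congr rfl fun j _ => Finset.sum_mul _ _ _
  rw [two_mul]
  nth_rewrite 1 [h1]
  rw [h2, ← Finset.sum_add_distrib, Finset.sum_mul_sum]
  refine Finset.sum_congr rfl fun i _ => ?_
  rw [← Finset.sum_add_distrib]
  refine Finset.sum_congr rfl fun j _ => ?_
  linear_combination x i * x j * hM i j

/-- These conditions make the weighted moments of the stage defects smaller than the defects
themselves. For m < η they follow from D(η) and the quadrature conditions; for m = η, from C(η) when
k < η. -/
theorem SatisfiesSymplecticIdentity.weighted_stage_condition (hM : M.SatisfiesSymplecticIdentity)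
    (hB : M.QuadratureOrder (2 * η + 2)) (hC : M.StageOrder η) {m k : ℕ} (hm : m ≤ η)
    (hk : k < 2 * η + 1 - m) :
    ∑ i, M.b i * M.c i ^ m * (M.c i ^ (k + 1) / ((k : ℝ) + 1)) =
      ∑ j, (∑ i, M.b i * M.c i ^ m * M.A i j) * M.c j ^ k := by
  have hk0 : (k : ℝ) + 1 ≠ 0 := by positivity
  have hL : ∑ i, M.b i * M.c i ^ m * (M.c i ^ (k + 1) / ((k : ℝ) + 1)) =
      1 / ((m : ℝ) + k + 2) / (k + 1) := by
    have h1 := hB (m + (k + 1)) (by omega)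
    push_cast at h1
    rw [show (m : ℝ) + k + 2 = m + (k + 1) + 1 by ring, ← h1, Finset.sum_div]
    exact Finset.sum_congr rfl fun i _ => by ring
  rcases hm.lt_or_eq with hm | rfl
  · rw [hL, Finset.sum_congr rfl fun j _ => by
      rw [hM.sum_weight_mul_A hC hm (hB m (by omega)) j]]
    have h1 := hB k (by omega)
    have h2 := hB (m + 1 + k) (by omega)
    have h3 : ∑ j, (M.b j - M.b j * M.c j ^ (m + 1)) / ((m : ℝ) + 1) * M.c j ^ k =
        (∑ j, M.b j * M.c j ^ k - ∑ j, M.b j * M.c j ^ (m + 1 + k)) / ((m : ℝ) + 1) := by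
      rw [← Finset.sum_sub_distrib, Finset.sum_div]
      exact Finset.sum_congr rfl fun j _ => by ring
    rw [h3, h1, h2]
    have h4 : (m : ℝ) + k + 2 ≠ 0 := by positivity
    have h5 : (m : ℝ) + 1 ≠ 0 := by positivity
    have h6 : ((m + 1 + k : ℕ) : ℝ) + 1 ≠ 0 := by positivity
    push_cast at h6 ⊢
    field_simp
    ring
  · rcases (show k ≤ m by omega).lt_or_eq with hk | rfl
    · have h1 : ∑ j, (∑ i, M.b i * M.c i ^ m * M.A i j) * M.c j ^ k =
          ∑ i, M.b i * M.c i ^ m * ∑ j, M.A i j * M.c j ^ k := by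
        simp only [Finset.sum_mul, Finset.mul_sum]
        rw [Finset.sum_comm]
        exact Finset.sum_congr rfl fun i _ => Finset.sum_congr rfl fun j _ => by ring
      rw [h1]
      exact Finset.sum_congr rfl fun i _ => by rw [hC k hk i]
    -- The case m = k = η is outside the reach of C(η) and D(η); symplecticity settles it.
    · have h1 := hM.sum_sum_mul_A_mul (fun i => M.c i ^ k)
      rw [hB k (by omega)] at h1
      rw [hL]
      have h2 : (k : ℝ) + k + 2 ≠ 0 := by positivity
      have h3 : ∑ j, (∑ i, M.b i * M.c i ^ k * M.A i j) * M.c j ^ k =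
        1 / ((k : ℝ) + 1) * (1 / ((k : ℝ) + 1)) / 2 := by linarith
      rw [h3]
      field_simp
      ring

/-! ### Local error by recursion on moments. -/

section Error

variable {E : Type*} [NormedAddCommGroup E] [NormedSpace ℝ E]

/-- The error of a quadrature formula for increments of `y` in terms of values of `y'`. -/
theorem vanishesToOrder_quadrature {y y' : ℝ → E} {t₀ : ℝ} {N K : ℕ}
    (hy : ∀ᶠ t in 𝓝 t₀, HasDerivAt y (y' t) t) (hy' : ContDiffAt ℝ N y' t₀) (hK : K ≤ N)
    {ι : Type*} [Fintype ι] (u γ : ι → ℝ) (w c : Fin s → ℝ)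
    (h : ∀ k < K, ∑ i, u i * (γ i ^ (k + 1) / ((k : ℝ) + 1)) = ∑ j, w j * c j ^ k) :
    VanishesToOrder (fun h => ∑ i, u i • (y (t₀ + γ i * h) - y t₀) -
      h • ∑ j, w j • y' (t₀ + c j * h)) (K + 1) := by
  obtain ⟨a, ha⟩ := exists_taylor_expansion (hy'.of_le (by exact_mod_cast hK : (K : WithTop ℕ∞) ≤ N))
  have h1 := vanishesToOrder_integrate hy ha
  have h2 : VanishesToOrder (fun h => ∑ i, u i • (y (t₀ + γ i * h) - y t₀ -
      ∑ k ∈ Finset.range K, ((γ i * h) ^ (k + 1) / ((k : ℝ) + 1)) • a k)) (K + 1) :=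
    VanishesToOrder.sum fun i _ => (h1.comp_mul_left (γ i)).const_smul (u i)
  have h3 : VanishesToOrder (fun h => h • ∑ j, w j • (y' (t₀ + c j * h) -
      ∑ k ∈ Finset.range K, (c j * h) ^ k • a k)) (K + 1) :=
    (VanishesToOrder.sum fun j _ => (ha.comp_mul_left (c j)).const_smul (w j)).smul_id
  refine (h2.sub h3).congr (Eventually.of_forall fun x => ?_)
  -- The Taylor polynomials cancel degree by degree; this is exactly the hypothesis on the
  -- coefficients.
  have h4 : ∑ i, u i • ∑ k ∈ Finset.range K, ((γ i * x) ^ (k + 1) / ((k : ℝ) + 1)) • a k =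
      x • ∑ j, w j • ∑ k ∈ Finset.range K, (c j * x) ^ k • a k := by
    simp only [Finset.smul_sum, smul_smul]
    rw [Finset.sum_comm, Finset.sum_comm (s := Finset.univ)]
    refine Finset.sum_congr rfl fun k hk => ?_
    rw [← Finset.sum_smul, ← Finset.sum_smul]
    congr 1
    have h5 := h k (Finset.mem_range.1 hk)
    have h6 : ∑ j, x * (w j * (c j * x) ^ k) = x ^ (k + 1) * ∑ j, w j * c j ^ k := by
      rw [Finset.mul_sum]; exact Finset.sum_congr rfl fun j _ => by ring
    rw [h6, ← h5, Finset.mul_sum]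
    exact Finset.sum_congr rfl fun j _ => by ring
  simp only [smul_sub, Finset.sum_sub_distrib] at h4 ⊢
  rw [h4]
  abel

/-- The moments of the stage errors `e` and of the corresponding slope errors `g` are small, if the
stage errors satisfy the perturbed linearized stage equations. -/
theorem SatisfiesSymplecticIdentity.vanishesToOrder_slope_moment
    (hM : M.SatisfiesSymplecticIdentity) (hB : M.QuadratureOrder (2 * η + 2))
    (hC : M.StageOrder η) {e g d : ℝ → Fin s → E} {a : ℕ → E →L[ℝ] E}
    (hstage : ∀ᶠ h in 𝓝 (0 : ℝ), ∀ i, e h i = h • ∑ j, M.A i j • g h j - d h i)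
    (he : ∀ i, VanishesToOrder (fun h => e h i) (η + 1))
    (hg : ∀ i, VanishesToOrder (fun h => g h i -
      ∑ k ∈ Finset.range (η + 1), (M.c i * h) ^ k • a k (e h i)) (2 * η + 2))
    (hd : ∀ m ≤ η, VanishesToOrder (fun h => ∑ i, (M.b i * M.c i ^ m) • d h i) (2 * η + 2 - m)) :
    VanishesToOrder (fun h => ∑ i, M.b i • g h i) (2 * η + 2) := by
  -- Moment m of `g` combines the moments m+k of `e` with factors h^k. That factor repays the loss
  -- of k in the bound 2η+2-(m+k).
  have hG : ∀ δ, (∀ m, VanishesToOrder (fun h => ∑ i, (M.b i * M.c i ^ m) • e h i)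
      (min (η + 1 + δ) (2 * η + 2 - m))) → ∀ m,
      VanishesToOrder (fun h => ∑ i, (M.b i * M.c i ^ m) • g h i)
      (min (η + 1 + δ) (2 * η + 2 - m)) := by
    intro δ hS m
    have h1 : VanishesToOrder (fun h => ∑ i, (M.b i * M.c i ^ m) • (g h i -
        ∑ k ∈ Finset.range (η + 1), (M.c i * h) ^ k • a k (e h i)))
        (min (η + 1 + δ) (2 * η + 2 - m)) :=
      (VanishesToOrder.sum fun i _ => (hg i).const_smul _).mono (by omega)
    have h2 : VanishesToOrder (fun h => ∑ k ∈ Finset.range (η + 1),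
        h ^ k • a k (∑ i, (M.b i * M.c i ^ (m + k)) • e h i))
        (min (η + 1 + δ) (2 * η + 2 - m)) :=
      VanishesToOrder.sum fun k _ => (((hS (m + k)).const_clm (a k)).pow_smul k).mono (by omega)
    refine (h1.add h2).congr (Eventually.of_forall fun h => ?_)
    have h3 : ∑ k ∈ Finset.range (η + 1), h ^ k • a k (∑ i, (M.b i * M.c i ^ (m + k)) • e h i) =
        ∑ i, (M.b i * M.c i ^ m) • ∑ k ∈ Finset.range (η + 1), (M.c i * h) ^ k • a k (e h i) := by
      simp only [map_sum, map_smul, Finset.smul_sum, smul_smul]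
      rw [Finset.sum_comm]
      refine Finset.sum_congr rfl fun i _ => Finset.sum_congr rfl fun k _ => ?_
      congr 1
      ring
    rw [h3]
    simp only [smul_sub, Finset.sum_sub_distrib]
    abel
  have hbase : ∀ m, VanishesToOrder (fun h => ∑ i, (M.b i * M.c i ^ m) • e h i) (η + 1) :=
    fun m => VanishesToOrder.sum fun i _ => (he i).const_smul _
  -- Each pass through the stage equations gains one power of h, up to the ceiling 2η+2-m.
  have hS : ∀ δ m, VanishesToOrder (fun h => ∑ i, (M.b i * M.c i ^ m) • e h i)
      (min (η + 1 + δ) (2 * η + 2 - m)) := by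
    intro δ
    induction δ with
    | zero => exact fun m => (hbase m).mono (by omega)
    | succ δ ih =>
      intro m
      have hGδ := hG δ ih
      have hsplit : ∀ᶠ h in 𝓝 (0 : ℝ), h • ∑ j, (∑ i, M.b i * M.c i ^ m * M.A i j) • g h j -
          ∑ i, (M.b i * M.c i ^ m) • d h i = ∑ i, (M.b i * M.c i ^ m) • e h i := by
        filter_upwards [hstage] with h hh
        have h1 : ∑ i, (M.b i * M.c i ^ m) • e h i =
            ∑ i, (M.b i * M.c i ^ m) • (h • ∑ j, M.A i j • g h j - d h i) :=
          Finset.sum_congr rfl fun i _ => by rw [hh i]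
        rw [h1]
        simp only [smul_sub, Finset.sum_sub_distrib, Finset.smul_sum, Finset.sum_smul, smul_smul]
        congr 1
        rw [Finset.sum_comm]
        refine Finset.sum_congr rfl fun i _ => Finset.sum_congr rfl fun j _ => ?_
        congr 1
        ring
      -- For m < η, D(η) reduces the sum to moments 0 and m+1 of `g`. For m = η the ceiling is only
      -- η+2, which h times the plain bound on `g` attains. For m > η it is at most η+1, already
      -- known.
      rcases lt_trichotomy m η with hm | rfl | hm
      · refine VanishesToOrder.congr ?_ hsplit
        refine VanishesToOrder.sub ?_ ((hd m hm.le).mono (by omega))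
        have h1 : VanishesToOrder (fun h => ((1 : ℝ) / ((m : ℝ) + 1)) •
            (h • ∑ i, (M.b i * M.c i ^ 0) • g h i - h • ∑ i, (M.b i * M.c i ^ (m + 1)) • g h i))
            (min (η + 1 + (δ + 1)) (2 * η + 2 - m)) :=
          ((((hGδ 0).smul_id).mono (by omega)).sub
            (((hGδ (m + 1)).smul_id).mono (by omega))).const_smul _
        refine h1.congr (Eventually.of_forall fun h => ?_)
        simp only [hM.sum_weight_mul_A hC hm (hB m (by omega)), pow_zero, mul_one]
        rw [← smul_sub, smul_comm, ← Finset.sum_sub_distrib, Finset.smul_sum]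
        congr 1
        refine Finset.sum_congr rfl fun j _ => ?_
        rw [← sub_smul, smul_smul]
        congr 1
        ring
      · refine VanishesToOrder.congr ?_ hsplit
        refine VanishesToOrder.sub ?_ ((hd m le_rfl).mono (by omega))
        have hgj : ∀ j, VanishesToOrder (fun h => g h j) (m + 1) := by
          intro j
          have h1 : VanishesToOrder (fun h => ∑ k ∈ Finset.range (m + 1),
              M.c j ^ k • (h ^ k • a k (e h j))) (m + 1) :=
            VanishesToOrder.sum fun k _ =>
              ((((he j).const_clm (a k)).pow_smul k).const_smul _).mono (by omega)
          refine (((hg j).mono (by omega)).add h1).congr (Eventually.of_forall fun h => ?_)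
          simp only [smul_smul, ← mul_pow]
          abel
        exact ((VanishesToOrder.sum fun j _ => (hgj j).const_smul _).smul_id).mono (by omega)
      · exact (hbase m).mono (by omega)
  have := hG (η + 1) (hS (η + 1)) 0
  simp only [pow_zero, mul_one] at this
  exact this.mono (by omega)

/-- The local error of a solution of the stage equations close to the starting point. -/
theorem SatisfiesSymplecticIdentity.vanishesToOrder_step_sub
    (hM : M.SatisfiesSymplecticIdentity) (hB : M.QuadratureOrder (2 * η + 2))
    (hC : M.StageOrder η) {f : ℝ → E → E} {t₀ : ℝ} {y : ℝ → E}
    (hf : ContDiffAt ℝ (2 * η + 2 : ℕ) (Function.uncurry f) (t₀, y t₀))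
    (hy : ∀ᶠ t in 𝓝 t₀, HasDerivAt y (f t (y t)) t) {Y : ℝ → Fin s → E}
    (hY0 : Tendsto Y (𝓝 0) (𝓝 fun _ => y t₀))
    (hY : ∀ᶠ h in 𝓝 (0 : ℝ), M.IsStages f t₀ h (y t₀) (Y h)) :
    VanishesToOrder (fun h => M.step f t₀ h (y t₀) (Y h) - y (t₀ + h)) (2 * η + 3) := by
  have hysm := contDiffAt_solution hf hy
  have hyc : ContDiffAt ℝ (2 * η + 2 : ℕ) (fun t => f t (y t)) t₀ :=
    ContDiffAt.comp (g := Function.uncurry f) (f := fun t => (t, y t)) t₀ hf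
      (contDiffAt_id.prodMk hysm)
  -- exact values at the abscissae, stage errors, slope errors, and stage defects
  set Z : ℝ → Fin s → E := fun h i => y (t₀ + M.c i * h) with hZ
  set e : ℝ → Fin s → E := fun h i => Y h i - Z h i with he_def
  set g : ℝ → Fin s → E := fun h i =>
    f (t₀ + M.c i * h) (Y h i) - f (t₀ + M.c i * h) (Z h i) with hg_def
  set d : ℝ → Fin s → E := fun h i =>
    (y (t₀ + M.c i * h) - y t₀) - h • ∑ j, M.A i j • f (t₀ + M.c j * h) (Z h j) with hd_def
  set J : ℝ → E →L[ℝ] E := fun t =>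
    fderiv ℝ (Function.uncurry f) (t, y t) ∘L .inr ℝ ℝ E with hJ_def
  have htime : ∀ i, Tendsto (fun h : ℝ => t₀ + M.c i * h) (𝓝 0) (𝓝 t₀) := by
    intro i
    have : Continuous fun h : ℝ => t₀ + M.c i * h := by fun_prop
    simpa using this.tendsto 0
  have hYi : ∀ i, Tendsto (fun h => Y h i) (𝓝 0) (𝓝 (y t₀)) := fun i =>
    (tendsto_pi_nhds.1 hY0) i
  have hZi : ∀ i, Tendsto (fun h => Z h i) (𝓝 0) (𝓝 (y t₀)) := fun i =>
    hysm.continuousAt.tendsto.comp (htime i)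
  have hJ : ContDiffAt ℝ (η + 1 : ℕ) J t₀ := by
    have h1 : ContDiffAt ℝ (η + 1 : ℕ) (fderiv ℝ (Function.uncurry f)) (t₀, y t₀) :=
      hf.fderiv_right (by exact_mod_cast (by omega : η + 1 + 1 ≤ 2 * η + 2))
    have h2 : ContDiffAt ℝ (η + 1 : ℕ)
        (fun t => fderiv ℝ (Function.uncurry f) (t, y t)) t₀ :=
      ContDiffAt.comp (g := fderiv ℝ (Function.uncurry f)) (f := fun t => (t, y t)) t₀ h1
        (contDiffAt_id.prodMk (hysm.of_le (by exact_mod_cast (by omega : η + 1 ≤ 2 * η + 2))))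
    exact h2.clm_comp contDiffAt_const
  have hstage : ∀ᶠ h in 𝓝 (0 : ℝ), ∀ i, e h i = h • ∑ j, M.A i j • g h j - d h i := by
    filter_upwards [hY] with h hh i
    simp only [he_def, hd_def, hg_def, hZ, smul_sub, Finset.sum_sub_distrib]
    rw [hh i]
    abel
  -- the linearization of the slope errors
  have hlin : ∀ i, (fun h => g h i - J (t₀ + M.c i * h) (e h i)) =O[𝓝 (0 : ℝ)]
      fun h => ‖e h i‖ * ‖e h i‖ := by
    intro i
    obtain ⟨C, hCq⟩ := exists_norm_sub_sub_fderiv_le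
      (hf.of_le (by exact_mod_cast (by omega : 2 ≤ 2 * η + 2) : (2 : WithTop ℕ∞) ≤ (2 * η + 2 : ℕ)))
    refine IsBigO.of_bound C ?_
    have ht : Tendsto (fun h : ℝ => ((t₀ + M.c i * h, Z h i), (t₀ + M.c i * h, Y h i))) (𝓝 0)
        (𝓝 ((t₀, y t₀), (t₀, y t₀))) :=
      ((htime i).prodMk_nhds (hZi i)).prodMk_nhds ((htime i).prodMk_nhds (hYi i))
    filter_upwards [ht.eventually hCq] with h hh
    have h1 : ((t₀ + M.c i * h, Y h i) : ℝ × E) - (t₀ + M.c i * h, Z h i) = (0, e h i) := by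
      simp [he_def]
    rw [h1] at hh
    rw [Real.norm_of_nonneg (by positivity)]
    simpa [hg_def, hJ_def, hZ] using hh
  have hJb : ∀ i, VanishesToOrder (fun h => J (t₀ + M.c i * h)) 0 := by
    intro i
    have := (hJ.continuousAt.tendsto.comp (htime i)).isBigO_one ℝ
    simpa [VanishesToOrder] using this
  have he0 : ∀ i, Tendsto (fun h => e h i) (𝓝 0) (𝓝 0) := by
    intro i
    simpa using (hYi i).sub (hZi i)
  -- the stage errors are bounded by the stage defects
  have hge : ∀ i, (fun h => g h i) =O[𝓝 (0 : ℝ)] e := by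
    intro i
    have hei : (fun h => e h i) =O[𝓝 (0 : ℝ)] e := (isBigO_pi.1 (isBigO_refl e (𝓝 0))) i
    have h1 : (fun h => ‖e h i‖ * ‖e h i‖) =O[𝓝 (0 : ℝ)] e := by
      have h2 := ((he0 i).isBigO_one ℝ).norm_left.mul hei.norm_norm
      simpa using h2.norm_right
    have h3 : (fun h => J (t₀ + M.c i * h) (e h i)) =O[𝓝 (0 : ℝ)] e := by
      have h4 : (fun h => J (t₀ + M.c i * h) (e h i)) =O[𝓝 (0 : ℝ)]
          fun h => ‖J (t₀ + M.c i * h)‖ * ‖e h i‖ :=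
        IsBigO.of_bound 1 (Eventually.of_forall fun h => by
          rw [one_mul, Real.norm_of_nonneg (by positivity)]
          exact ContinuousLinearMap.le_opNorm _ _)
      have h5 := (hJb i).norm_left.mul hei.norm_norm
      simp only [pow_zero, one_mul] at h5
      exact h4.trans (h5.trans (isBigO_refl _ _).norm_left)
    simpa using ((hlin i).trans h1).add h3
  -- As `g` is O(`e`), the term hA`g` is o(`e`) and is absorbed in the stage equations.
  have hed : e =O[𝓝 (0 : ℝ)] d := by
    have h1 : (fun h i => -(h • ∑ j, M.A i j • g h j) : ℝ → Fin s → E) =o[𝓝 (0 : ℝ)] e := by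
      rw [isLittleO_pi]
      intro i
      refine IsLittleO.neg_left ?_
      have h2 : (fun h => ∑ j, M.A i j • g h j) =O[𝓝 (0 : ℝ)] e :=
        IsBigO.fun_sum fun j _ => (hge j).const_smul_left _
      have h3 : (fun h : ℝ => h) =o[𝓝 (0 : ℝ)] fun _ => (1 : ℝ) :=
        (isLittleO_one_iff ℝ).2 tendsto_id
      have h4 := h3.smul_isBigO h2
      simpa using h4
    have h5 := h1.right_isBigO_add
    have h6 : (fun h => (fun i => -(h • ∑ j, M.A i j • g h j)) + e h) =ᶠ[𝓝 (0 : ℝ)]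
        fun h => -d h := by
      filter_upwards [hstage] with h hh
      ext i
      simp only [Pi.add_apply, Pi.neg_apply, hh i]
      abel
    exact isBigO_neg_right.1 (h5.congr' EventuallyEq.rfl h6)
  have hdi : ∀ i, VanishesToOrder (fun h => d h i) (η + 1) := by
    intro i
    have := vanishesToOrder_quadrature (s := s) (K := η) hy hyc (by omega) (fun _ : Unit => (1 : ℝ))
      (fun _ => M.c i) (M.A i) M.c (fun k hk => by simpa using (hC k hk i).symm)
    simpa [hd_def] using this
  have hdm : ∀ m ≤ η,
      VanishesToOrder (fun h => ∑ i, (M.b i * M.c i ^ m) • d h i) (2 * η + 2 - m) := by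
    intro m hm
    have := vanishesToOrder_quadrature (s := s) (K := 2 * η + 1 - m) hy hyc (by omega)
      (fun i => M.b i * M.c i ^ m) M.c (fun j => ∑ i, M.b i * M.c i ^ m * M.A i j) M.c
      (fun k hk => hM.weighted_stage_condition hB hC hm hk)
    rw [show 2 * η + 2 - m = 2 * η + 1 - m + 1 by omega]
    refine this.congr (Eventually.of_forall fun h => ?_)
    simp only [hd_def, smul_sub, Finset.sum_sub_distrib, Finset.smul_sum, Finset.sum_smul,
      smul_smul]
    congr 1
    rw [Finset.sum_comm]
    refine Finset.sum_congr rfl fun i _ => Finset.sum_congr rfl fun j _ => ?_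
    congr 1
    ring
  have hei : ∀ i, VanishesToOrder (fun h => e h i) (η + 1) :=
    isBigO_pi.1 (hed.trans (isBigO_pi.2 hdi))
  obtain ⟨a, ha⟩ := exists_taylor_expansion hJ
  have hgexp : ∀ i, VanishesToOrder (fun h => g h i -
      -- Both the quadratic remainder and the Taylor remainder of `J` applied to `e` have order
      -- (η+1)+(η+1).
      ∑ k ∈ Finset.range (η + 1), (M.c i * h) ^ k • a k (e h i)) (2 * η + 2) := by
    intro i
    have h1 : VanishesToOrder (fun h => g h i - J (t₀ + M.c i * h) (e h i)) (2 * η + 2) := by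
      have h2 := (hei i).norm_left.mul (hei i).norm_left
      simp only [← pow_add] at h2
      have h3 := (hlin i).trans h2
      rwa [show η + 1 + (η + 1) = 2 * η + 2 by ring] at h3
    have h4 := ((ha.comp_mul_left (M.c i)).clm_apply (hei i)).mono
      (show 2 * η + 2 ≤ η + 1 + (η + 1) by omega)
    refine (h1.add h4).congr (Eventually.of_forall fun h => ?_)
    simp [_root_.sum_apply]
  have hslope := hM.vanishesToOrder_slope_moment hB hC hstage hei hgexp hdm
  have hq := vanishesToOrder_quadrature (s := s) (K := 2 * η + 2) hy hyc le_rfl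
    (fun _ : Unit => (1 : ℝ)) (fun _ => 1) M.b M.c
    (fun k hk => by simpa using (hB k hk).symm)
  refine (hslope.smul_id.sub hq).congr (Eventually.of_forall fun h => ?_)
  simp only [step, hg_def, hZ, smul_sub, Finset.sum_sub_distrib, Finset.univ_unique,
    Finset.sum_singleton, one_smul, one_mul]
  abel

end Error

/-- A method of stage order `η` that satisfies the symplectic identity and has quadrature order
`2 * η + 2` has order `2 * η + 2`. -/
theorem SatisfiesSymplecticIdentity.hasOrder (hM : M.SatisfiesSymplecticIdentity)
    (hB : M.QuadratureOrder (2 * η + 2)) (hC : M.StageOrder η) : M.HasOrder (2 * η + 2) := by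
  refine ⟨2 * η + 2, fun E _ _ _ U f t₀ y hU hf hmem hy => ?_⟩
  have : CompleteSpace E := FiniteDimensional.complete ℝ E
  have hfa : ContDiffAt ℝ (2 * η + 2 : ℕ) (Function.uncurry f) (t₀, y t₀) :=
    (hf _ hmem).contDiffAt (hU.mem_nhds hmem)
  obtain ⟨φ, hφ, hφ0, hst, huniq⟩ := M.exists_stages (hfa.of_le
    (by exact_mod_cast (by omega : 1 ≤ 2 * η + 2) : (1 : WithTop ℕ∞) ≤ (2 * η + 2 : ℕ)))
  have hpt : Tendsto (fun h : ℝ => (h, y t₀)) (𝓝 0) (𝓝 (0, y t₀)) :=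
    tendsto_id.prodMk_nhds tendsto_const_nhds
  have hY0 : Tendsto (fun h => φ (h, y t₀)) (𝓝 0) (𝓝 fun _ => y t₀) := by
    have := hφ.continuousAt.tendsto.comp hpt
    rwa [hφ0] at this
  have hY := hpt.eventually hst
  obtain ⟨C, hC'⟩ := (hM.vanishesToOrder_step_sub hB hC hfa hy hY0 hY).bound
  obtain ⟨ε, hε, hball⟩ := Metric.eventually_nhds_iff_ball.1 huniq
  have hin : ∀ᶠ h in 𝓝 (0 : ℝ), φ (h, y t₀) ∈ Metric.ball (fun _ : Fin s => y t₀) ε :=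
    hY0 (Metric.ball_mem_nhds _ hε)
  obtain ⟨ρ, hρ, hρball⟩ := Metric.eventually_nhds_iff_ball.1 (hY.and (hC'.and hin))
  -- The radius ρ secures existence and the error bound. The stepsize must also stay below ε because
  -- the uniqueness neighbourhood lies in the space of triples (h, y, Y).
  refine ⟨ε, hε, min ρ ε / 2, by positivity, C, fun h hh => ?_⟩
  have hhρ : h ∈ Metric.ball (0 : ℝ) ρ := by
    rw [mem_ball_zero_iff, Real.norm_eq_abs]
    have := min_le_left ρ ε
    linarith
  have hhε : |h| < ε := by
    have := min_le_right ρ ε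
    linarith
  obtain ⟨h1, h2, h3⟩ := hρball h hhρ
  refine ⟨φ (h, y t₀), ⟨fun i => ?_, h1⟩, fun Z hZ hZst => ?_, ?_⟩
  · exact (dist_pi_lt_iff hε).1 h3 i
  · refine (hball ((h, y t₀), Z) ?_ hZst).symm
    rw [← ball_prod_same, ← ball_prod_same]
    refine ⟨⟨?_, Metric.mem_ball_self hε⟩, (dist_pi_lt_iff hε).2 hZ⟩
    rwa [mem_ball_zero_iff, Real.norm_eq_abs]
  · rwa [norm_pow, Real.norm_eq_abs] at h2

end ButcherTableau

/-! ### Necessary order conditions -/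

namespace ButcherTableau

variable {s : ℕ} {M : ButcherTableau s}

/-- The order conditions obtained from the problems `u' = t ^ q`, `v' = t ^ m * u ^ n`. -/
theorem HasOrder.sum_weight_mul {p : ℕ} (hM : M.HasOrder p) {q m n : ℕ}
    (hp : m + n * (q + 1) + 1 ≤ p) :
    ∑ i, M.b i * (M.c i ^ m * (∑ j, M.A i j * M.c j ^ q) ^ n) =
      1 / (((q : ℝ) + 1) ^ n * ((m : ℝ) + n * (q + 1) + 1)) := by
  obtain ⟨k, hk⟩ := hM
  set N := m + n * (q + 1) + 1 with hN
  have hNr : ((m : ℝ) + n * (q + 1) + 1) = N := by rw [hN]; push_cast; ring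
  have hN0 : (N : ℝ) ≠ 0 := by rw [← hNr]; positivity
  have hq0 : (q : ℝ) + 1 ≠ 0 := by positivity
  rw [hNr]
  set S := ∑ i, M.b i * (M.c i ^ m * (∑ j, M.A i j * M.c j ^ q) ^ n) with hS
  set κ := 1 / (((q : ℝ) + 1) ^ n * N) with hκ
  -- Started at zero, this problem has second components exactly h^N S for the numerical step and
  -- h^N κ for the solution. An error O(h^(p+1)) with p ≥ N then forces S = κ.
  let f : ℝ → ℝ × ℝ → ℝ × ℝ := fun t x => (t ^ q, t ^ m * x.1 ^ n)
  let y : ℝ → ℝ × ℝ := fun t => (t ^ (q + 1) / ((q : ℝ) + 1), κ * t ^ N)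
  have hy : ∀ t, HasDerivAt y (f t (y t)) t := by
    intro t
    have h1 := (hasDerivAt_pow (q + 1) t).div_const ((q : ℝ) + 1)
    have h2 := (hasDerivAt_pow N t).const_mul κ
    have e1 : ((q + 1 : ℕ) : ℝ) * t ^ (q + 1 - 1) / ((q : ℝ) + 1) = t ^ q := by
      rw [Nat.add_sub_cancel]
      push_cast
      field_simp
    have e2 : κ * ((N : ℝ) * t ^ (N - 1)) = t ^ m * (t ^ (q + 1) / ((q : ℝ) + 1)) ^ n := by
      rw [hκ, show N - 1 = m + (q + 1) * n by rw [hN, mul_comm n]; rfl, pow_add, pow_mul, div_pow]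
      field_simp
    rw [e1] at h1
    rw [e2] at h2
    exact h1.prodMk h2
  have hy0 : y 0 = 0 := by simp [y, hN]
  obtain ⟨δ, -, h₀, hh₀, C, hC⟩ := hk (ℝ × ℝ) Set.univ f 0 y isOpen_univ
    (ContDiff.contDiffOn (by unfold f Function.uncurry; fun_prop)) (Set.mem_univ _)
    (Filter.Eventually.of_forall hy)
  have hbound : ∀ h ∈ Set.Ioo (0 : ℝ) (min h₀ 1), |S - κ| ≤ |C| * h := by
    rintro h ⟨hpos, hlt⟩
    have hlt0 : h < h₀ := hlt.trans_le (min_le_left _ _)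
    have hlt1 : h < 1 := hlt.trans_le (min_le_right _ _)
    obtain ⟨Y, ⟨-, hst⟩, -, herr⟩ := hC h (by rw [abs_of_pos hpos]; exact hlt0.le)
    have hY : ∀ i, (Y i).1 = h ^ (q + 1) * ∑ j, M.A i j * M.c j ^ q := by
      intro i
      have h1 := congrArg Prod.fst (hst i)
      simp only [hy0, Prod.smul_fst, Prod.fst_sum, f, zero_add,
        smul_eq_mul] at h1
      rw [h1, Finset.mul_sum, Finset.mul_sum]
      exact Finset.sum_congr rfl fun j _ => by ring
    have hstep : (M.step f 0 h (y 0) Y).2 = h ^ N * S := by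
      simp only [step, hy0, Prod.smul_snd, Prod.snd_sum, f, zero_add,
        smul_eq_mul, hY, hS, hN]
      rw [Finset.mul_sum, Finset.mul_sum]
      exact Finset.sum_congr rfl fun j _ => by ring
    have h2 : |h ^ N * (S - κ)| ≤ C * |h| ^ (p + 1) := by
      refine le_trans (le_of_eq ?_) ((norm_snd_le _).trans herr)
      rw [Prod.snd_sub, hstep, Real.norm_eq_abs]
      simp only [y, zero_add]
      congr 1
      ring
    rw [abs_mul, abs_of_pos (pow_pos hpos N), abs_of_pos hpos] at h2
    have h3 : C * h ^ (p + 1) ≤ h ^ N * (|C| * h) := by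
      have h4 : h ^ (p + 1) ≤ h ^ (N + 1) := pow_le_pow_of_le_one hpos.le hlt1.le (by omega)
      calc C * h ^ (p + 1) ≤ |C| * h ^ (N + 1) := by
            gcongr
            exact le_abs_self C
        _ = h ^ N * (|C| * h) := by ring
    exact le_of_mul_le_mul_left (h2.trans h3) (pow_pos hpos N)
  have hlim : Filter.Tendsto (fun h : ℝ => |C| * h) (𝓝[>] 0) (𝓝 0) := by
    have h1 : Continuous fun h : ℝ => |C| * h := by fun_prop
    have h2 := h1.tendsto 0
    simp only [mul_zero] at h2
    exact h2.mono_left nhdsWithin_le_nhds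
  have hle : |S - κ| ≤ 0 := ge_of_tendsto hlim
    (Filter.mem_of_superset (Ioo_mem_nhdsGT (lt_min hh₀ one_pos)) hbound)
  exact sub_eq_zero.1 (abs_eq_zero.1 (le_antisymm hle (abs_nonneg _)))

end ButcherTableau

/-! ### Sharpness of the order. -/

open Polynomial in
/-- The Gauss–Legendre formula with `s` nodes is not exact in degree `2 * s`. -/
theorem sum_gaussWeight_mul_pow_ne (s : ℕ) :
    ∑ i, gaussWeight s i * gaussNode s i ^ (2 * s) ≠ 1 / ((2 * s : ℕ) + 1 : ℝ) := by
  intro h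
  set P := legendrePoly s with hP
  -- The square of P has integral 1 but vanishes at the nodes. Exactness on `R` would transfer this
  -- discrepancy to the monomial of degree 2s.
  set R := P * P - C ((P * P).coeff (2 * s)) * X ^ (2 * s) with hR
  have hdeg : R.degree < (2 * s : ℕ) := by
    rw [degree_lt_iff_coeff_zero]
    intro k hk
    rw [hR, coeff_sub, coeff_C_mul, coeff_X_pow]
    rcases hk.lt_or_eq with hk | hk
    · rw [if_neg (by omega), mul_zero, sub_zero]
      refine coeff_eq_zero_of_degree_lt ?_
      rw [degree_mul, hP, degree_legendrePoly]
      exact_mod_cast (by omega : s + s < k)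
    · rw [hk]; simp
  have h1 := sum_gaussWeight_mul_eval s hdeg
  rw [hR, map_sub, polyIntegral.C_mul, polyIntegral.X_pow, hP, polyIntegral_legendrePoly_mul,
    if_pos rfl] at h1
  simp only [eval_sub, eval_mul, eval_gaussNode_legendrePoly, eval_C, eval_pow, eval_X, mul_zero,
    zero_sub, mul_neg, Finset.sum_neg_distrib] at h1
  have h2 : ∀ a : ℝ, ∑ i, gaussWeight s i * (a * gaussNode s i ^ (2 * s)) =
      a * ∑ i, gaussWeight s i * gaussNode s i ^ (2 * s) := by
    intro a
    rw [Finset.mul_sum]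
    exact Finset.sum_congr rfl fun i _ => by ring
  rw [h2, h] at h1
  linarith

theorem not_hasOrder_perturbedGauss (s r : ℕ) (hr : r + 1 < s)
    (V : Matrix (Fin (r + 1)) (Fin (r + 1)) ℝ)
    (hV0 : r = 0 ∨ ∃ i, V i 0 ≠ 0) :
    ¬ (perturbedGauss s r V).HasOrder (2 * (s - r) + 1) := by
  intro h
  rcases Nat.eq_zero_or_pos r with rfl | hr0
  · have h1 := h.sum_weight_mul (q := 0) (m := 2 * s) (n := 0) (by omega)
    refine sum_gaussWeight_mul_pow_ne s ?_
    simpa [perturbedGauss] using h1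
  · obtain ⟨i, hi⟩ := hV0.resolve_left (by omega)
    refine hi (first_column_eq_zero s r V hr ?_ i)
    set M := perturbedGauss s r V with hM
    set η := s - (r + 1) with hη
    have hη0 : (η : ℝ) + 1 ≠ 0 := by positivity
    have h1 := h.sum_weight_mul (q := η) (m := η + 1) (n := 1) (by omega)
    have h2 := h.sum_weight_mul (q := η) (m := 0) (n := 2) (by omega)
    -- Since r > 0, the degree 2η+2 = 2(s-r) is below 2s.
    have h3 := perturbedGauss_quadratureOrder s r V (2 * η + 2) (by omega)
    set α : Fin s → ℝ := fun i => ∑ j, M.A i j * M.c j ^ η with hα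
    -- Expanding the square gives the three sums just evaluated. Positive weights then force every
    -- stage defect in degree η to vanish.
    have hsq : ∑ i, M.b i * (α i - M.c i ^ (η + 1) / ((η : ℝ) + 1)) ^ 2 = 0 := by
      have h4 : ∑ i, M.b i * (α i - M.c i ^ (η + 1) / ((η : ℝ) + 1)) ^ 2 =
          ∑ i, M.b i * (M.c i ^ 0 * α i ^ 2) -
            2 / ((η : ℝ) + 1) * ∑ i, M.b i * (M.c i ^ (η + 1) * α i ^ 1) +
            1 / ((η : ℝ) + 1) ^ 2 * ∑ i, M.b i * M.c i ^ (2 * η + 2) := by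
        rw [Finset.mul_sum, Finset.mul_sum, ← Finset.sum_sub_distrib, ← Finset.sum_add_distrib]
        refine Finset.sum_congr rfl fun i _ => ?_
        field_simp
        ring
      rw [h4, h1, h2, h3]
      have h5 : (2 * (η : ℝ) + 3) ≠ 0 := by positivity
      have e1 : ((η + 1 : ℕ) : ℝ) + (1 : ℕ) * ((η : ℝ) + 1) + 1 = 2 * η + 3 := by push_cast; ring
      have e2 : ((0 : ℕ) : ℝ) + (2 : ℕ) * ((η : ℝ) + 1) + 1 = 2 * η + 3 := by push_cast; ring
      have e3 : ((2 * η + 2 : ℕ) : ℝ) + 1 = 2 * η + 3 := by push_cast; ring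
      rw [e1, e2, e3]
      field_simp
      ring
    intro i
    have h6 := (Finset.sum_eq_zero_iff_of_nonneg fun i _ =>
      mul_nonneg (gaussWeight_pos s i).le (sq_nonneg _)).1 hsq i (Finset.mem_univ i)
    have h7 := (mul_eq_zero.1 h6).resolve_left (gaussWeight_pos s i).ne'
    exact sub_eq_zero.1 (pow_eq_zero_iff two_ne_zero |>.1 h7)

theorem theorem2p2 (s r : ℕ) (hr : r + 1 < s) (V : Matrix (Fin (r + 1)) (Fin (r + 1)) ℝ)
    (hV : V.transpose = -V) :
    (perturbedGauss s r V).IsSymplectic ∧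
    (perturbedGauss s r V).HasOrder (2 * (s - r)) ∧
    ((r = 0 ∨ ∃ i, V i 0 ≠ 0) → ¬ (perturbedGauss s r V).HasOrder (2 * (s - r) + 1)) := by
  have hM := perturbedGauss_symplecticIdentity s r V (by omega) hV
  refine ⟨hM.isSymplectic, ?_, not_hasOrder_perturbedGauss s r hr V⟩
  rw [show 2 * (s - r) = 2 * (s - (r + 1)) + 2 by omega]
  exact hM.hasOrder (fun m hm => perturbedGauss_quadratureOrder s r V m (by omega))
    (perturbedGauss_stageOrder s r V)
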